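/- Notation. For a group $G$, a subgroup $H\le G$ and $g\in G$ with $HgH=Hg^{-1}H$ (and $g\notin H$), the coset graph $\mathrm{Cos}(G,H,HgH)$ has as vertices the right cosets of $H$ in $G$, with $Hx$ and $Hy$ adjacent if and only if $yx^{-1}\in HgH$. Let $f$ be a positive integer and $T=\mathrm{PSL}(2,2^f)$; write $t_{a,b,c,d}\in T$ for the element $x\mapsto (ax+b)/(cx+d)$, and let $\tau\in\mathrm{Aut}(T)$ be $t_{a,b,c,d}\mapsto t_{a^2,b^2,c^2,d^2}$. Let $a=t_{1,1,1,0}$, $b=t_{1,1,0,1}$, let $H=\mathrm{PSL}(2,2)\le T$ be the subgroup of those $t_{a,b,c,d}$ with $a,b,c,d\in\mathrm{GF}(2)$, and for $\alpha\in\mathrm{GF}(2^f)$ let $u_\alpha=t_{1,\alpha,0,1}$. Let $G=T^2\rtimes\langle\pi\rangle$, where $\pi$ is the automorphism $(x,y)\mapsto(y,x)$ of $T^2$, let $L=\langle(a,a),(b,b)\rangle$ and $g_\alpha=(u_\alpha,bu_\alpha)\pi$. Then $Lg_\alpha L=Lg_\alpha^{-1}L$, and $\Gamma(f,\alpha):=\mathrm{Cos}(G,L,Lg_\alpha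 L)$. For $\sigma\in\mathrm{Aut}(T)$, $\langle T,\sigma\rangle$ is the subgroup of $\mathrm{Aut}(T)$ generated by $\sigma$ and $T$, where $T$ is identified with its group of inner automorphisms. An element $\alpha$ of $\mathrm{GF}(2^f)$ is a generator if it lies in no proper subfield of $\mathrm{GF}(2^f)$. Proposition. Let $f\ge 2$ and let $\alpha\in\mathrm{GF}(2^f)$ be a generator. (a) If $f$ is odd, or if $f$ is even and $\alpha^{2^{f/2}}\neq\alpha+1$, then $\Gamma(f,\alpha)$ is connected. (b) If $f$ is even and $\alpha^{2^{f/2}}=\alpha+1$, then $\Gamma(f,\alpha)$ has $|T|$ connected components, each containing $|T|/3$ vertices and isomorphic to the (well-defined) coset graph $\mathrm{Cos}(\langle T,\nu\rangle,H,Hu_\alpha\nu H)$, where $\nu=\tau^{f/2}$. -/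

import Mathlib

open scoped Matrix MatrixGroups

noncomputable section

/-- The coset graph `Cos(G, H, HgH)`, where `HgH = Hg⁻¹H`: its vertices are the right cosets of `H`
in `G`, and `Hx`, `Hy` are adjacent if and only if `y * x⁻¹ ∈ HgH`. The condition `g ∉ H` says that
this relation has no loops, so that it is a simple graph. -/
def cosetGraph {G : Type*} [Group G] (H : Subgroup G) (g : G)
    (hsymm : DoubleCoset.doubleCoset g (H : Set G) H = DoubleCoset.doubleCoset g⁻¹ (H : Set G) H)
    (hg : g ∉ H) : SimpleGraph (Quotient (QuotientGroup.rightRel H)) where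
  Adj v w := ∃ x y : G, v = Quotient.mk _ x ∧ w = Quotient.mk _ y ∧
    y * x⁻¹ ∈ DoubleCoset.doubleCoset g (H : Set G) H
  symm := ⟨by
    rintro v w ⟨x, y, hv, hw, hxy⟩
    refine ⟨y, x, hw, hv, ?_⟩
    rw [hsymm]
    obtain ⟨h, hh, k, hk, e⟩ := DoubleCoset.mem_doubleCoset.1 hxy
    refine DoubleCoset.mem_doubleCoset.2 ⟨k⁻¹, H.inv_mem hk, h⁻¹, H.inv_mem hh, ?_⟩
    calc x * y⁻¹ = (y * x⁻¹)⁻¹ := by group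
      _ = k⁻¹ * g⁻¹ * h⁻¹ := by rw [e]; group⟩
  loopless := ⟨by
    rintro v ⟨x, y, hv, hw, hxy⟩
    have hr : y * x⁻¹ ∈ H := QuotientGroup.rightRel_apply.1 (Quotient.exact (hv.symm.trans hw))
    obtain ⟨h, hh, k, hk, e⟩ := DoubleCoset.mem_doubleCoset.1 hxy
    apply hg
    have : g = h⁻¹ * (y * x⁻¹) * k⁻¹ := by rw [e]; group
    rw [this]
    exact H.mul_mem (H.mul_mem (H.inv_mem hh) hr) (H.inv_mem hk)⟩

namespace TwoArcFamily

/-- The group `T = PSL(2, 2 ^ f)`. -/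
abbrev T (f : ℕ) : Type := PSL(2, GaloisField 2 f)

/-- The element `t_{a,b,c,d} : x ↦ (a x + b) / (c x + d)` of `T`, given by a matrix
of determinant one. -/
def t {f : ℕ} (a b c d : GaloisField 2 f) (h : a * d - b * c = 1) : T f :=
  QuotientGroup.mk (⟨!![a, b; c, d], by rw [Matrix.det_fin_two_of]; exact h⟩ : SL(2, GaloisField 2 f))

/-- `a : x ↦ 1 + 1 / x`. -/
def a (f : ℕ) : T f := t 1 1 1 0 (by rw [CharTwo.sub_eq_add]; simp)

/-- `u_α : x ↦ x + α`. -/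
def u {f : ℕ} (α : GaloisField 2 f) : T f := t 1 α 0 1 (by simp)

/-- `b = u_1 : x ↦ x + 1`. -/
def b (f : ℕ) : T f := u 1

/-- The subgroup `H = PSL(2, 2)` of `T`: the elements `t_{a,b,c,d}` with `a, b, c, d` in the prime
field `GF(2)`. -/
def H (f : ℕ) : Subgroup (T f) :=
  ((QuotientGroup.mk' (Subgroup.center SL(2, GaloisField 2 f))).comp
    (Matrix.SpecialLinearGroup.map (algebraMap (ZMod 2) (GaloisField 2 f)))).range

/-- The automorphism of `SL(2, 2 ^ f)` that squares all matrix entries. -/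
def frobSL (f : ℕ) : SL(2, GaloisField 2 f) ≃* SL(2, GaloisField 2 f) :=
  MonoidHom.toMulEquiv
    (Matrix.SpecialLinearGroup.map (frobeniusEquiv (GaloisField 2 f) 2 : _ →+* _))
    (Matrix.SpecialLinearGroup.map ((frobeniusEquiv (GaloisField 2 f) 2).symm : _ →+* _))
    (by ext A i j; simp) (by ext A i j; simp)

/-- The automorphism `τ : t_{a,b,c,d} ↦ t_{a²,b²,c²,d²}` of `T`. -/
def τ (f : ℕ) : MulAut (T f) :=
  QuotientGroup.congr _ _ (frobSL f)
    (Subgroup.characteristic_iff_map_eq.1 inferInstance (frobSL f))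

/-- The automorphism `(x, y) ↦ (y, x)` of `T²`. -/
def swap (f : ℕ) : MulAut (T f × T f) := MulEquiv.prodComm

/-- The group `G = T² ⋊ ⟨π⟩`, where `π` is the swap automorphism. -/
abbrev G (f : ℕ) : Type :=
  (T f × T f) ⋊[(Subgroup.zpowers (swap f)).subtype] (Subgroup.zpowers (swap f))

/-- The element `π` of `G`. -/
def π (f : ℕ) : G f := SemidirectProduct.inr ⟨swap f, Subgroup.mem_zpowers _⟩

/-- The subgroup `L = ⟨(a, a), (b, b)⟩` of `G`. -/
def L (f : ℕ) : Subgroup (G f) :=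
  Subgroup.closure {SemidirectProduct.inl (a f, a f), SemidirectProduct.inl (b f, b f)}

/-- The element `g_α = (u_α, b u_α) π` of `G`. -/
def g {f : ℕ} (α : GaloisField 2 f) : G f :=
  SemidirectProduct.inl (u α, b f * u α) * π f

theorem u_mul {f : ℕ} (α β : GaloisField 2 f) : u α * u β = u (α + β) := by
  unfold u t
  refine (QuotientGroup.mk_mul _ _ _).symm.trans (congrArg _ ?_)
  apply Subtype.ext
  change !![1, α; 0, 1] * !![1, β; 0, 1] = !![1, α + β; 0, 1]
  simp [add_comm]

theorem u_zero {f : ℕ} : u (0 : GaloisField 2 f) = 1 := by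
  have h := u_mul (0 : GaloisField 2 f) 0
  rw [add_zero] at h
  exact mul_eq_left.1 h

theorem u_mul_self {f : ℕ} (α : GaloisField 2 f) : u α * u α = 1 := by
  rw [u_mul, CharTwo.add_self_eq_zero, u_zero]

theorem b_ne_one (f : ℕ) : b f ≠ 1 := by
  intro h
  have h' := (QuotientGroup.eq_one_iff _).1 h
  have h1 := Subgroup.mem_center_iff.1 h' ⟨!![1, 0; 1, 1], by simp⟩
  have h2 : (!![1, 0; 1, 1] * !![1, 1; 0, 1] : Matrix (Fin 2) (Fin 2) (GaloisField 2 f)) =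
    !![1, 1; 0, 1] * !![1, 0; 1, 1] := congrArg Subtype.val h1
  have h3 := congrFun (congrFun h2 0) 0
  simp at h3

theorem g_inv {f : ℕ} (α : GaloisField 2 f) :
    (g α)⁻¹ = g α * SemidirectProduct.inl (b f, b f) := by
  have hc : u α * b f = b f * u α := by rw [b, u_mul, u_mul, add_comm]
  have hb : b f * b f = 1 := u_mul_self 1
  have e1 : u α * (b f * u α * b f) = 1 := by
    rw [← hc, mul_assoc, hb, mul_one, u_mul_self]
  have e2 : b f * u α * (u α * b f) = 1 := by
    rw [mul_assoc (b f), ← mul_assoc (u α), u_mul_self, one_mul, hb]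
  have hg : g α = ⟨(u α, b f * u α), ⟨swap f, Subgroup.mem_zpowers _⟩⟩ :=
    (SemidirectProduct.mk_eq_inl_mul_inr _ _ ).symm
  have hr : g α * SemidirectProduct.inl (b f, b f) =
      ⟨(u α * b f, b f * u α * b f), ⟨swap f, Subgroup.mem_zpowers _⟩⟩ := by
    rw [hg]
    exact SemidirectProduct.ext rfl (mul_one _)
  rw [inv_eq_iff_mul_eq_one, hr, hg]
  exact SemidirectProduct.ext (Prod.ext e1 e2) (Subtype.ext (MulEquiv.ext fun _ => rfl))

theorem g_doubleCoset {f : ℕ} (α : GaloisField 2 f) :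
    DoubleCoset.doubleCoset (g α) (L f : Set (G f)) (L f) =
      DoubleCoset.doubleCoset (g α)⁻¹ (L f : Set (G f)) (L f) := by
  refine (DoubleCoset.doubleCoset_eq_of_mem (DoubleCoset.mem_doubleCoset.2
    ⟨1, (L f).one_mem, SemidirectProduct.inl (b f, b f), ?_, ?_⟩)).symm
  · exact Subgroup.subset_closure (by simp)
  · rw [one_mul, g_inv]

theorem g_notMem {f : ℕ} (α : GaloisField 2 f) : g α ∉ L f := by
  intro h
  have hle : L f ≤ (SemidirectProduct.rightHom : G f →* _).ker := by
    rw [L, Subgroup.closure_le]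
    rintro x (rfl | rfl) <;> simp
  have h1 := hle h
  have h2 : swap f = 1 := by
    simpa [g, π, MonoidHom.mem_ker, Subtype.ext_iff] using h1
  have h3 := congrArg Prod.fst (DFunLike.congr_fun h2 ((1, b f) : T f × T f))
  exact b_ne_one f h3

/-- The graph `Γ(f, α) = Cos(G, L, L g_α L)`. -/
def Γ (f : ℕ) (α : GaloisField 2 f) :
    SimpleGraph (Quotient (QuotientGroup.rightRel (L f))) :=
  cosetGraph (L f) (g α) (g_doubleCoset α) (g_notMem α)

/-- The subgroup `⟨T, σ⟩` of `Aut(T)`, where `σ ∈ Aut(T)` and `T`, whose centre is trivial, is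
identified with the group of its inner automorphisms. -/
def extT (f : ℕ) (σ : MulAut (T f)) : Subgroup (MulAut (T f)) :=
  (MulAut.conj : T f →* MulAut (T f)).range ⊔ Subgroup.zpowers σ

/-- The copy of `H = PSL(2, 2)` in `⟨T, σ⟩`. -/
def extH (f : ℕ) (σ : MulAut (T f)) : Subgroup (extT f σ) :=
  ((H f).map (MulAut.conj : T f →* MulAut (T f))).subgroupOf (extT f σ)

/-- The element `u_α σ` of `⟨T, σ⟩`. -/
def extU {f : ℕ} (α : GaloisField 2 f) (σ : MulAut (T f)) : extT f σ :=
  ⟨MulAut.conj (u α) * σ, mul_mem (Subgroup.mem_sup_left ⟨u α, rfl⟩)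
    (Subgroup.mem_sup_right (Subgroup.mem_zpowers σ))⟩

end TwoArcFamily

end

/-! The components of `Cos(G, L, LgL)` are governed by `X = ⟨L, g⟩`: they correspond to the right
cosets of `X`, and each is isomorphic to `Cos(X, L, LgL)`. So everything rests on computing `X`.

Let `N` be the intersection of `X` with `T²`. It contains the pairs `(h, h)` with `h ∈ H` and, by
conjugation with `g_α`, the pairs `(u_α h u_α, u_(α+1) h u_(α+1))`. Both projections of `N` are all
of `T`, because `H` and `u_α w u_α` generate `T`, where `w` is `x ↦ 1 / x`. As `T` is simple,
Goursat's lemma says that `N = T²`, whence `X = G`, or that `N` lies in the graph of an endomorphism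
`σ`. In the second case `σ` fixes `b` and `w`, so it acts on the elements `u_β` through a field
endomorphism `φ` with `φ α = α + 1`. Now `φ²` fixes a generator, so `φ` has order two and is `x ↦ x
^ 2 ^ (f / 2)` (`X_eq_top_or`). Conversely, if this map sends `α` to `α + 1`, then `ν` fixes `H` and
sends `u_α` to `u_(α+1)`; so `X` consists of the elements `(x, ν x) e` with `e ∈ ⟨π⟩`, is isomorphic
to `⟨T, ν⟩`, and has index `|T|` (`IsSwapping.X_eq_Y`, `IsSwapping.equivExt`).

Generation (`exists_subfield`, `eq_top_of_generator`) is proved by counting fixed points of a finite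
subgroup `M` of `SL(2)` on the projective line over an algebraically closed field. An involution
fixes one point, any other nontrivial element two. Let `n` be the length of the orbit of `∞` and `s`
the number of elements of square one fixing `∞`. The count leaves exactly one further orbit with
nontrivial stabilizers, of length `n (s - 2) + 2`. Divisibility then forces `n = s + 1`, unless that
length is two, which elements of order three exclude. Hence the `β` with `upper β ∈ M` form a
subfield which together with `∞` is the orbit of `∞`, and this orbit contains `α`. -/

namespace MulAction

/-! ### Weighted fixed-point counts for finite groups. -/

variable {M P : Type*} [Group M] [MulAction M P]

/-- The weight of a group element in the count of fixed points: twice as large for involutions as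
for elements of larger order. -/
noncomputable def fixWeight (h : M) : ℕ :=
  open Classical in if h = 1 then 0 else if h ^ 2 = 1 then 2 else 1

/-- The total weight of the elements that fix `x`. -/
noncomputable def pointWeight (M : Type*) {P : Type*} [Group M] [MulAction M P] [Fintype M]
    (x : P) : ℕ :=
  open Classical in ∑ h : M, if h • x = x then fixWeight h else 0

theorem fixWeight_conj (k h : M) : fixWeight (k * h * k⁻¹) = fixWeight h := by
  have h1 : k * h * k⁻¹ = 1 ↔ h = 1 := conj_eq_one_iff
  have h2 : (k * h * k⁻¹) ^ 2 = 1 ↔ h ^ 2 = 1 := by rw [conj_pow]; exact conj_eq_one_iff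
  unfold fixWeight
  by_cases e1 : h = 1
  · rw [if_pos e1, if_pos (h1.2 e1)]
  · rw [if_neg e1, if_neg (h1.not.2 e1)]
    by_cases e2 : h ^ 2 = 1
    · rw [if_pos e2, if_pos (h2.2 e2)]
    · rw [if_neg e2, if_neg (h2.not.2 e2)]

theorem pointWeight_smul [Fintype M] (k : M) (x : P) :
    pointWeight M (k • x) = pointWeight M x := by
  classical
  unfold pointWeight
  refine (Fintype.sum_equiv (MulAut.conj k).toEquiv _ _ fun h => ?_).symm
  have e : (MulAut.conj k).toEquiv h = k * h * k⁻¹ := rfl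
  rw [e, fixWeight_conj]
  congr 1
  rw [← mul_smul, inv_mul_cancel_right, mul_smul, smul_left_cancel_iff]

/-- On the right an involution is counted twice and an element of larger order once, as in the
weight; the identity, of weight zero, is also counted twice, hence the summand 2. -/
theorem pointWeight_add_two [Fintype M] (x : P) :
    pointWeight M x + 2 =
      Nat.card (stabilizer M x) + Nat.card {h : M // h • x = x ∧ h ^ 2 = 1} := by
  classical
  have e1 : Nat.card (stabilizer M x) = ∑ h : M, if h • x = x then 1 else 0 := by
    rw [Finset.sum_boole, Nat.cast_id, ← Fintype.card_subtype, ← Nat.card_eq_fintype_card]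
    rfl
  have e2 : Nat.card {h : M // h • x = x ∧ h ^ 2 = 1} =
      ∑ h : M, if h • x = x ∧ h ^ 2 = 1 then 1 else 0 := by
    rw [Finset.sum_boole, Nat.cast_id, ← Fintype.card_subtype, ← Nat.card_eq_fintype_card]
  have e3 : 2 = ∑ h : M, if h = 1 then 2 else 0 := by simp
  rw [e1, e2, pointWeight]
  nth_rw 1 [e3]
  rw [← Finset.sum_add_distrib, ← Finset.sum_add_distrib]
  refine Finset.sum_congr rfl fun h _ => ?_
  unfold fixWeight
  by_cases h1 : h = 1
  · simp [h1]
  · by_cases hx : h • x = x <;> by_cases h2 : h ^ 2 = 1 <;> simp [h1, hx, h2]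

/-- Every nontrivial element of the group has one fixed point if it is an involution and two fixed
points otherwise. -/
structure FixesOneOrTwo (M P : Type*) [Group M] [MulAction M P] : Prop where
  one : ∀ h : M, h ≠ 1 → h ^ 2 = 1 → ∃! x : P, h • x = x
  two : ∀ h : M, h ^ 2 ≠ 1 → ∃ x y : P, x ≠ y ∧ ∀ z, h • z = z ↔ z = x ∨ z = y

theorem fixWeight_mul_card_le [DecidableEq P] (hM : FixesOneOrTwo M P) (S : Finset P) (h : M)
    (h1 : h ≠ 1) : fixWeight h * (S.filter fun x => h • x = x).card ≤ 2 := by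
  classical
  unfold fixWeight
  rw [if_neg h1]
  by_cases h2 : h ^ 2 = 1
  · obtain ⟨x, -, hx⟩ := hM.one h h1 h2
    have : S.filter (fun x => h • x = x) ⊆ {x} := fun z hz =>
      Finset.mem_singleton.2 (hx z (Finset.mem_filter.1 hz).2)
    have := Finset.card_le_card this
    rw [Finset.card_singleton] at this
    rw [if_pos h2]
    lia
  · obtain ⟨x, y, hxy, hz⟩ := hM.two h h2
    have : S.filter (fun x => h • x = x) ⊆ {x, y} := fun z hz' => by
      simpa using (hz z).1 (Finset.mem_filter.1 hz').2
    have := Finset.card_le_card this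
    rw [Finset.card_pair hxy] at this
    rw [if_neg h2]
    lia

theorem fixWeight_mul_card_eq [DecidableEq P] (hM : FixesOneOrTwo M P) (S : Finset P) (h : M)
    (h1 : h ≠ 1) (hS : ∀ x : P, h • x = x → x ∈ S) :
    fixWeight h * (S.filter fun x => h • x = x).card = 2 := by
  classical
  unfold fixWeight
  rw [if_neg h1]
  by_cases h2 : h ^ 2 = 1
  · obtain ⟨x, hx0, hx⟩ := hM.one h h1 h2
    have : S.filter (fun x => h • x = x) = {x} := by
      ext z
      simp only [Finset.mem_filter, Finset.mem_singleton]
      exact ⟨fun hz => hx z hz.2, by rintro rfl; exact ⟨hS _ hx0, hx0⟩⟩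
    rw [this, Finset.card_singleton, if_pos h2]
  · obtain ⟨x, y, hxy, hz⟩ := hM.two h h2
    have : S.filter (fun x => h • x = x) = {x, y} := by
      ext z
      simp only [Finset.mem_filter, Finset.mem_insert, Finset.mem_singleton, ← hz]
      exact ⟨fun h => h.2, fun h => ⟨hS _ h, h⟩⟩
    rw [this, Finset.card_pair hxy, if_neg h2]

theorem sum_pointWeight [Fintype M] [DecidableEq P] (S : Finset P) :
    ∑ x ∈ S, pointWeight M x =
      ∑ h : M, fixWeight h * (S.filter fun x => h • x = x).card := by
  classical
  unfold pointWeight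
  rw [Finset.sum_comm]
  refine Finset.sum_congr rfl fun h _ => ?_
  rw [Finset.card_filter, Finset.mul_sum]
  refine Finset.sum_congr rfl fun x _ => ?_
  split_ifs <;> simp

theorem sum_two_add_two [Fintype M] [DecidableEq M] :
    (∑ h : M, if h = 1 then 0 else 2) + 2 = 2 * Nat.card M := by
  have e3 : 2 = ∑ h : M, if h = 1 then 2 else 0 := by simp
  nth_rw 2 [e3]
  rw [← Finset.sum_add_distrib, Nat.card_eq_fintype_card,
    Finset.sum_congr rfl (g := fun _ => 2) (fun h _ => by split_ifs <;> rfl)]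
  simp [mul_comm]

/-- Double counting: the weights are chosen so that each nontrivial element contributes 2 over all
its fixed points, hence at most 2 over those in `S`. -/
theorem sum_pointWeight_le [Fintype M] [DecidableEq P] (hM : FixesOneOrTwo M P) (S : Finset P) :
    ∑ x ∈ S, pointWeight M x + 2 ≤ 2 * Nat.card M := by
  classical
  rw [sum_pointWeight, ← sum_two_add_two]
  gcongr with h
  split_ifs with h1
  · simp [fixWeight, h1]
  · exact fixWeight_mul_card_le hM S h h1

theorem sum_pointWeight_eq [Fintype M] [DecidableEq P] (hM : FixesOneOrTwo M P) (S : Finset P)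
    (hS : ∀ (h : M) (x : P), h ≠ 1 → h • x = x → x ∈ S) :
    ∑ x ∈ S, pointWeight M x + 2 = 2 * Nat.card M := by
  classical
  rw [sum_pointWeight, ← sum_two_add_two]
  congr 1
  refine Finset.sum_congr rfl fun h _ => ?_
  split_ifs with h1
  · simp [fixWeight, h1]
  · exact fixWeight_mul_card_eq hM S h h1 fun x => hS h x h1

theorem card_orbit_mul_card_stabilizer [Finite M] (x : P) :
    Nat.card (orbit M x) * Nat.card (stabilizer M x) = Nat.card M := by
  rw [Nat.card_congr (orbitEquivQuotientStabilizer M x), ← Subgroup.index_eq_card,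
    Subgroup.index_mul_card]

instance finite_orbit [Finite M] (x : P) : Finite (orbit M x) :=
  Set.finite_range _

/-- The orbit of a point under a finite group, as a finset. -/
noncomputable def orbitFinset (M : Type*) {P : Type*} [Group M] [MulAction M P] [Finite M]
    (x : P) : Finset P :=
  (Set.toFinite (orbit M x)).toFinset

theorem mem_orbitFinset [Finite M] {x y : P} : y ∈ orbitFinset M x ↔ y ∈ orbit M x := by
  simp [orbitFinset]

theorem card_orbitFinset [Finite M] (x : P) :
    (orbitFinset M x).card = Nat.card (orbit M x) := by
  rw [orbitFinset, ← Set.ncard_eq_toFinset_card _ (Set.toFinite _), Nat.card_coe_set_eq]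

/-- The weight is constant on orbits, so orbit–stabilizer gives the total `|M| + n (s - 2)`, with
`n` the orbit length and `s` the number of elements of square one fixing `x`. The form is additive
because `s` may be 1. -/
theorem sum_orbit_pointWeight [Fintype M] (x : P) :
    ∑ y ∈ orbitFinset M x, pointWeight M y + 2 * Nat.card (orbit M x) =
      Nat.card M + Nat.card (orbit M x) * Nat.card {h : M // h • x = x ∧ h ^ 2 = 1} := by
  have : ∀ y ∈ orbitFinset M x, pointWeight M y = pointWeight M x := by
    intro y hy
    obtain ⟨k, rfl⟩ := mem_orbitFinset.1 hy
    exact pointWeight_smul k x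
  rw [Finset.sum_congr rfl this, Finset.sum_const, card_orbitFinset, smul_eq_mul, mul_comm 2,
    ← mul_add, pointWeight_add_two, mul_add, card_orbit_mul_card_stabilizer]

theorem disjoint_orbitFinset [Finite M] {x y : P} (h : y ∉ orbit M x) :
    Disjoint (orbitFinset M x) (orbitFinset M y) := by
  rw [Finset.disjoint_left]
  intro z hz hz'
  rw [mem_orbitFinset] at hz hz'
  exact h (orbit_eq_iff.1 ((orbit_eq_iff.2 hz').symm.trans (orbit_eq_iff.2 hz)))

theorem card_involutions_pos [Finite M] (x : P) :
    0 < Nat.card {h : M // h • x = x ∧ h ^ 2 = 1} :=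
  have : Nonempty {h : M // h • x = x ∧ h ^ 2 = 1} := ⟨⟨1, by simp⟩⟩
  Nat.card_pos

/-- Off the orbit of a point that is fixed by an involution, point stabilizers have odd order. -/
theorem odd_card_stabilizer [Finite M] (hM : FixesOneOrTwo M P) {p x : P}
    (hp : 2 ≤ Nat.card {h : M // h • p = p ∧ h ^ 2 = 1}) (hx : x ∉ orbit M p) :
    Odd (Nat.card (stabilizer M x)) := by
  classical
  have := Fintype.ofFinite M
  have hle := sum_pointWeight_le hM (orbitFinset M p ∪ orbitFinset M x)
  rw [Finset.sum_union (disjoint_orbitFinset hx)] at hle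
  have h1 := sum_orbit_pointWeight (M := M) p
  have h2 := sum_orbit_pointWeight (M := M) x
  have h3 := card_involutions_pos (M := M) x
  by_contra hodd
  rw [Nat.not_odd_iff_even, even_iff_two_dvd] at hodd
  obtain ⟨h, hh⟩ := exists_prime_orderOf_dvd_card' (G := stabilizer M x) 2 hodd
  have h4 : 1 < Nat.card {h : M // h • x = x ∧ h ^ 2 = 1} := by
    rw [Finite.one_lt_card_iff_nontrivial]
    refine ⟨⟨1, by simp⟩, ⟨h.1, h.2, ?_⟩, fun e => ?_⟩
    · have := pow_orderOf_eq_one h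
      rw [hh] at this
      exact congrArg Subtype.val this
    · have e' : h = 1 := Subtype.ext (congrArg Subtype.val e).symm
      rw [e', orderOf_one] at hh
      omega
  -- Two orbits whose points are fixed by involutions would each have total weight at least `|M|`,
  -- but the total is at most `2 |M| - 2`.
  nlinarith [Nat.mul_le_mul_left (Nat.card (orbit M p)) hp,
    Nat.mul_le_mul_left (Nat.card (orbit M x)) h4]

theorem card_involutions_eq_one [Finite M] (x : P) (hx : Odd (Nat.card (stabilizer M x))) :
    Nat.card {h : M // h • x = x ∧ h ^ 2 = 1} = 1 := by
  rw [Nat.card_eq_one_iff_unique]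
  refine ⟨⟨?_⟩, ⟨1, by simp⟩⟩
  have key : ∀ h : M, h • x = x → h ^ 2 = 1 → h = 1 := by
    intro h h1 h2
    have e : (⟨h, h1⟩ : stabilizer M x) ^ 2 = 1 := Subtype.ext h2
    have := orderOf_dvd_of_pow_eq_one e
    have h3 := orderOf_dvd_natCard (⟨h, h1⟩ : stabilizer M x)
    have h4 := (Nat.Coprime.eq_one_of_dvd (Nat.Coprime.coprime_dvd_left h3
      (Nat.coprime_two_right.2 hx)) this)
    exact congrArg Subtype.val (orderOf_eq_one_iff.1 h4)
  rintro ⟨h, h1, h2⟩ ⟨k, k1, k2⟩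
  exact Subtype.ext ((key h h1 h2).trans (key k k1 k2).symm)

/-- An involution fixes just one point, so the orbit of this point has odd length. -/
theorem odd_card_orbit [Finite M] (hM : FixesOneOrTwo M P) {p : P} {h : M} (h1 : h ≠ 1)
    (h2 : h ^ 2 = 1) (hp : h • p = p) : Odd (Nat.card (orbit M p)) := by
  classical
  have := Fintype.ofFinite (orbit M p)
  let e : Function.End (orbit M p) := fun x => h • x
  have hfix : Fintype.card (Function.fixedPoints e) = 1 := by
    rw [Fintype.card_eq_one_iff]
    refine ⟨⟨⟨p, mem_orbit_self p⟩, Subtype.ext hp⟩, ?_⟩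
    rintro ⟨⟨y, hy⟩, hy'⟩
    exact Subtype.ext (Subtype.ext ((hM.one h h1 h2).unique (congrArg Subtype.val hy') hp))
  have hinv : e ^ 2 ^ 1 = 1 := by
    refine funext fun x => Subtype.ext ?_
    change h • h • (x : P) = x
    rw [← mul_smul, ← sq, h2, one_smul]
  have := Equiv.Perm.card_fixedPoints_modEq (p := 2) (n := 1)  hinv
  rw [hfix, ← Nat.card_eq_fintype_card] at this
  exact Nat.odd_iff.2 this

/-- The orbit of `p` uses up `|M| + n (s - 2)` of the total weight `2 |M| - 2`. An orbit off it has
`s = 1` and weight `|M|` minus its length, so if exactly one other orbit has nontrivial stabilizers,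
its length is `n (s - 2) + 2`. -/
theorem exists_orbit_of_card_involutions [Finite M] (hM : FixesOneOrTwo M P) {p : P}
    (hp : 2 ≤ Nat.card {h : M // h • p = p ∧ h ^ 2 = 1}) {k : M} (hk : k • p ≠ p) :
    ∃ x : P, x ∉ orbit M p ∧ Odd (Nat.card (stabilizer M x)) ∧
      Nat.card (orbit M p) * (Nat.card {h : M // h • p = p ∧ h ^ 2 = 1} - 2) + 2 =
        Nat.card (orbit M x) := by
  classical
  have := Fintype.ofFinite M
  obtain ⟨s, hs⟩ := Nat.exists_eq_add_of_le hp
  have h1 := sum_orbit_pointWeight (M := M) p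
  have h1' := card_orbit_mul_card_stabilizer (M := M) p
  by_cases hx : ∃ (x : P) (h : M), x ∉ orbit M p ∧ h ≠ 1 ∧ h • x = x
  · obtain ⟨x, h, hx, hne, hhx⟩ := hx
    refine ⟨x, hx, odd_card_stabilizer hM hp hx, ?_⟩
    have h2 := sum_orbit_pointWeight (M := M) x
    rw [card_involutions_eq_one x (odd_card_stabilizer hM hp hx)] at h2
    have h2' := card_orbit_mul_card_stabilizer (M := M) x
    -- Nontrivial stabilizers of odd order have at least 3 elements, so such an orbit has weight at
    -- least `2 |M| / 3`; two of them, besides the orbit of `p`, would exceed the total.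
    have three : ∀ y : P, y ∉ orbit M p → (∃ h : M, h ≠ 1 ∧ h • y = y) →
        3 ≤ Nat.card (stabilizer M y) := by
      rintro y hy ⟨h, hne, hhy⟩
      have h3 := odd_card_stabilizer hM hp hy
      have h4 : 1 < Nat.card (stabilizer M y) := by
        rw [Finite.one_lt_card_iff_nontrivial]
        exact ⟨1, ⟨h, hhy⟩, fun e => hne (congrArg Subtype.val e).symm⟩
      obtain ⟨n, hn⟩ := h3
      omega
    have h4 := three x hx ⟨h, hne, hhx⟩
    have hall : ∀ (h : M) (y : P), h ≠ 1 → h • y = y → y ∈ orbitFinset M p ∪ orbitFinset M x := by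
      intro h y hne hhy
      rw [Finset.mem_union, mem_orbitFinset, mem_orbitFinset]
      by_contra hcon
      push Not at hcon
      obtain ⟨hy1, hy2⟩ := hcon
      have h3 := sum_orbit_pointWeight (M := M) y
      rw [card_involutions_eq_one y (odd_card_stabilizer hM hp hy1)] at h3
      have h3' := card_orbit_mul_card_stabilizer (M := M) y
      have h5 := three y hy1 ⟨h, hne, hhy⟩
      have hle := sum_pointWeight_le hM ((orbitFinset M p ∪ orbitFinset M x) ∪ orbitFinset M y)
      rw [Finset.sum_union (Finset.disjoint_union_left.2
        ⟨disjoint_orbitFinset hy1, disjoint_orbitFinset hy2⟩),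
        Finset.sum_union (disjoint_orbitFinset hx)] at hle
      have := Nat.mul_le_mul_left (Nat.card (orbit M p)) hp
      have := Nat.mul_le_mul_left (Nat.card (orbit M x)) h4
      have := Nat.mul_le_mul_left (Nat.card (orbit M y)) h5
      have : 0 < Nat.card M := Nat.card_pos
      omega
    have heq := sum_pointWeight_eq hM _ hall
    rw [Finset.sum_union (disjoint_orbitFinset hx)] at heq
    rw [hs] at h1 ⊢
    rw [Nat.add_sub_cancel_left]
    rw [mul_add] at h1
    omega
  · push Not at hx
    exfalso
    have heq := sum_pointWeight_eq hM (orbitFinset M p) fun h y hne hhy =>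
      mem_orbitFinset.2 (by_contra fun hy => hx y h hy hne hhy)
    rw [hs, mul_add] at h1
    -- Without a second orbit the count reads `n (s - 2) + 2 = |M|`, so `n` divides 2; being odd,
    -- `n` is 1, although `k` moves `p`.
    have hdvd : Nat.card (orbit M p) ∣ 2 := by
      rw [← Nat.dvd_add_right (b := Nat.card (orbit M p) * s) ⟨s, rfl⟩]
      exact ⟨Nat.card (stabilizer M p), by omega⟩
    have := Finite.one_lt_card_iff_nontrivial.1 (lt_of_lt_of_le one_lt_two hp)
    obtain ⟨h, hne⟩ := exists_ne (⟨1, by simp⟩ : {h : M // h • p = p ∧ h ^ 2 = 1})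
    have hodd := odd_card_orbit hM (h := h.1) (fun e => hne (Subtype.ext e)) h.2.2 h.2.1
    have h1 := Nat.Coprime.eq_one_of_dvd (Nat.coprime_two_right.2 hodd) hdvd
    rw [Nat.card_eq_one_iff_unique] at h1
    exact hk (congrArg Subtype.val (h1.1.elim ⟨k • p, mem_orbit p k⟩ ⟨p, mem_orbit_self p⟩))

/-- If two elements `h`, `h'` of square one that fix `p` agree on `k • p`, then `h * h'` has square
one and fixes both `p` and `k • p`, hence is trivial. So the points `h • k • p` are distinct, and
none of them is `p`. -/
theorem card_involutions_lt_card_orbit [Finite M] (hM : FixesOneOrTwo M P) {p : P}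
    (hU : ∀ h h' : M, h • p = p → h' • p = p → h ^ 2 = 1 → h' ^ 2 = 1 → (h * h') ^ 2 = 1)
    {k : M} (hk : k • p ≠ p) :
    Nat.card {h : M // h • p = p ∧ h ^ 2 = 1} + 1 ≤ Nat.card (orbit M p) := by
  rw [← Finite.card_option]
  refine Nat.card_le_card_of_injective (fun o : Option _ => o.elim
    (⟨p, mem_orbit_self p⟩ : orbit M p) fun h => ⟨h.1 • k • p, by
      rw [← mul_smul]; exact mem_orbit p _⟩) ?_
  have key : ∀ h : M, h • p = p → h • k • p ≠ p := fun h hp he =>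
    hk (smul_left_cancel h (he.trans hp.symm))
  rintro (_ | ⟨h, h1, h2⟩) (_ | ⟨h', h1', h2'⟩) e
  · rfl
  · exact absurd (congrArg Subtype.val e).symm (key _ h1')
  · exact absurd (congrArg Subtype.val e) (key _ h1)
  · have e' : h • k • p = h' • k • p := congrArg Subtype.val e
    have hinv : h⁻¹ = h := inv_eq_of_mul_eq_one_left (by rwa [← sq])
    have e2 : (h * h') • k • p = k • p := by
      rw [mul_smul, ← e', ← mul_smul, ← sq, h2, one_smul]
    have e3 : h * h' = 1 := by
      by_contra hne
      exact hk ((hM.one _ hne (hU h h' h1 h1' h2 h2')).unique e2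
        (by rw [mul_smul, h1', h1]))
    have : h = h' := hinv.symm.trans (inv_eq_of_mul_eq_one_right e3)
    subst this
    rfl

/-- Let `p` be a point fixed by `s ≥ 2` elements of square one. If its stabilizer has order at most
`s * (s - 1)`, then the group has an orbit of length two, or the orbit of `p` has length `s + 1`. -/
theorem orbit_dichotomy [Finite M] (hM : FixesOneOrTwo M P) {p : P}
    (hp : 2 ≤ Nat.card {h : M // h • p = p ∧ h ^ 2 = 1})
    (hU : ∀ h h' : M, h • p = p → h' • p = p → h ^ 2 = 1 → h' ^ 2 = 1 → (h * h') ^ 2 = 1)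
    {k : M} (hk : k • p ≠ p)
    (hm : Nat.card (stabilizer M p) ≤ Nat.card {h : M // h • p = p ∧ h ^ 2 = 1} *
      (Nat.card {h : M // h • p = p ∧ h ^ 2 = 1} - 1)) :
    (∃ x : P, Nat.card (orbit M x) = 2) ∨
      (Nat.card (orbit M p) = Nat.card {h : M // h • p = p ∧ h ^ 2 = 1} + 1 ∧
       Nat.card (stabilizer M p) = Nat.card {h : M // h • p = p ∧ h ^ 2 = 1} *
        (Nat.card {h : M // h • p = p ∧ h ^ 2 = 1} - 1)) := by
  obtain ⟨x, -, -, hx⟩ := exists_orbit_of_card_involutions hM hp hk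
  have hN := card_involutions_lt_card_orbit hM hU hk
  have := Finite.one_lt_card_iff_nontrivial.1 (lt_of_lt_of_le one_lt_two hp)
  obtain ⟨h, hne⟩ := exists_ne (⟨1, by simp⟩ : {h : M // h • p = p ∧ h ^ 2 = 1})
  have hodd := odd_card_orbit hM (h := h.1) (fun e => hne (Subtype.ext e)) h.2.2 h.2.1
  have h1 := card_orbit_mul_card_stabilizer (M := M) p
  have h2 := card_orbit_mul_card_stabilizer (M := M) x
  generalize Nat.card {h : M // h • p = p ∧ h ^ 2 = 1} = s at *
  obtain ⟨r, rfl⟩ := Nat.exists_eq_add_of_le hp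
  generalize hNN : Nat.card (orbit M p) = N at *
  generalize hmm : Nat.card (stabilizer M p) = m at *
  -- Here `r = s - 2`, and the second orbit has length `N * r + 2`.
  rcases Nat.eq_zero_or_pos r with rfl | hr
  · left
    exact ⟨x, by rw [← hx]; simp⟩
  right
  rw [Nat.add_sub_cancel_left] at hx
  have e1 : 2 + r - 1 = r + 1 := by omega
  rw [e1] at hm ⊢
  -- Both orbit lengths divide the group order and are coprime, as `N` is odd. Hence `N * r + 2`
  -- divides `m`, and `m ≤ (r + 2) * (r + 1)` bounds `N` by `r + 3`, which is also the lower bound.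
  have hcop : Nat.Coprime N (N * r + 2) := by
    rw [Nat.coprime_mul_left_add_right]
    exact Nat.coprime_two_right.2 hodd
  obtain ⟨e, he⟩ : N ∣ Nat.card (stabilizer M x) := by
    refine hcop.dvd_of_dvd_mul_left ?_
    rw [hx, h2, ← h1]
    exact Dvd.intro m rfl
  have hNpos : 0 < N := by omega
  have e2 : (N * r + 2) * e = m := by
    refine Nat.eq_of_mul_eq_mul_left hNpos ?_
    rw [h1, ← h2, ← hx, he]
    ring
  have hepos : 1 ≤ e := by
    rcases Nat.eq_zero_or_pos e with rfl | h
    · rw [mul_zero] at e2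
      have : 0 < Nat.card M := Nat.card_pos
      rw [← h1, ← e2] at this
      omega
    · exact h
  have e3 : N * r + 2 ≤ m := by nlinarith
  have e4 : N * r ≤ (3 + r) * r := by nlinarith
  have e5 : N ≤ 3 + r := Nat.le_of_mul_le_mul_right e4 hr
  have e6 : N = 3 + r := by omega
  refine ⟨by omega, le_antisymm hm ?_⟩
  calc (2 + r) * (r + 1) = N * r + 2 := by rw [e6]; ring
    _ ≤ m := e3

end MulAction

/-! ### `SL(2, K)` in characteristic two acting on the projective line. -/

namespace CharTwoSL

open OnePoint MulAction

section Action

variable {K : Type*} [Field K]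

/-- The action of `SL(2, K)` on the projective line by fractional linear transformations. -/
noncomputable instance projectiveLineAction : MulAction SL(2, K) (OnePoint K) :=
  open Classical in MulAction.compHom _ Matrix.SpecialLinearGroup.toGL

theorem smul_infty_iff (h : SL(2, K)) : h • (∞ : OnePoint K) = ∞ ↔ h.1 1 0 = 0 := by
  classical
  exact OnePoint.smul_infty_eq_self_iff (g := Matrix.SpecialLinearGroup.toGL h)

theorem smul_infty_coe (h : SL(2, K)) (z : K) (hz : h.1 0 0 = z * h.1 1 0) (hc : h.1 1 0 ≠ 0) :
    h • (∞ : OnePoint K) = z := by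
  classical
  have : h • (∞ : OnePoint K) = if h.1 1 0 = 0 then ∞ else (h.1 0 0 / h.1 1 0 : K) :=
    OnePoint.smul_infty_eq_ite (Matrix.SpecialLinearGroup.toGL h)
  rw [this, if_neg hc, hz, mul_div_cancel_right₀ _ hc]

theorem smul_coe_eq (h : SL(2, K)) (z y : K) (hd : h.1 1 0 * z + h.1 1 1 ≠ 0)
    (hy : h.1 0 0 * z + h.1 0 1 = y * (h.1 1 0 * z + h.1 1 1)) :
    h • (z : OnePoint K) = y := by
  classical
  have e : h • (z : OnePoint K) = if h.1 1 0 * z + h.1 1 1 = 0 then ∞ else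
      ((h.1 0 0 * z + h.1 0 1) / (h.1 1 0 * z + h.1 1 1) : K) :=
    OnePoint.smul_some_eq_ite (g := Matrix.SpecialLinearGroup.toGL h)
  rw [e, if_neg hd, hy, mul_div_cancel_right₀ _ hd]

theorem det_eq_one (h : SL(2, K)) : h.1 0 0 * h.1 1 1 - h.1 0 1 * h.1 1 0 = 1 := by
  rw [← Matrix.det_fin_two]; exact h.2

theorem smul_coe_iff (h : SL(2, K)) (z : K) :
    h • (z : OnePoint K) = z ↔ h.1 1 0 * z ^ 2 + (h.1 1 1 - h.1 0 0) * z - h.1 0 1 = 0 := by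
  classical
  have e : h • (z : OnePoint K) = if h.1 1 0 * z + h.1 1 1 = 0 then ∞ else
      ((h.1 0 0 * z + h.1 0 1) / (h.1 1 0 * z + h.1 1 1) : K) :=
    OnePoint.smul_some_eq_ite (g := Matrix.SpecialLinearGroup.toGL h)
  have hd := det_eq_one h
  rw [e]
  split_ifs with h0
  · refine ⟨fun h => absurd h (infty_ne_coe _), fun h1 => ?_⟩
    grind
  · rw [coe_eq_coe, div_eq_iff h0]
    grind

theorem ext_entries {h k : SL(2, K)} (h00 : h.1 0 0 = k.1 0 0) (h01 : h.1 0 1 = k.1 0 1)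
    (h10 : h.1 1 0 = k.1 1 0) (h11 : h.1 1 1 = k.1 1 1) : h = k := by
  apply Subtype.ext
  rw [Matrix.eta_fin_two h.1, Matrix.eta_fin_two k.1, h00, h01, h10, h11]

theorem mul_entries (h k : SL(2, K)) :
    (h * k).1 = !![h.1 0 0 * k.1 0 0 + h.1 0 1 * k.1 1 0, h.1 0 0 * k.1 0 1 + h.1 0 1 * k.1 1 1;
      h.1 1 0 * k.1 0 0 + h.1 1 1 * k.1 1 0, h.1 1 0 * k.1 0 1 + h.1 1 1 * k.1 1 1] := by
  change h.1 * k.1 = _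
  conv_lhs => rw [Matrix.eta_fin_two h.1, Matrix.eta_fin_two k.1, Matrix.mul_fin_two]

/-- The upper unitriangular matrix with entry `β`. -/
def upper (β : K) : SL(2, K) := ⟨!![1, β; 0, 1], by simp⟩

theorem upper_mul (β γ : K) : upper β * upper γ = upper (β + γ) := by
  apply Subtype.ext
  rw [mul_entries]
  simp [upper, add_comm]

theorem upper_zero : upper (0 : K) = 1 := by
  apply ext_entries <;> simp [upper]

theorem upper_injective : Function.Injective (upper : K → SL(2, K)) := fun _ _ h =>
  congrFun (congrFun (congrArg Subtype.val h) 0) 1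

instance finite_upper (M : Subgroup SL(2, K)) [Finite M] : Finite {β : K | upper β ∈ M} :=
  Finite.of_injective (fun β => (⟨upper β.1, β.2⟩ : M)) fun _ _ h =>
    Subtype.ext (upper_injective (congrArg Subtype.val h))

theorem card_diff_zero (M : Subgroup SL(2, K)) [Finite M] :
    Nat.card ({β : K | upper β ∈ M} \ {0} : Set K) = Nat.card {β : K | upper β ∈ M} - 1 := by
  rw [Nat.card_coe_set_eq, Nat.card_coe_set_eq, Set.ncard_sdiff_singleton_of_mem]
  change upper 0 ∈ M
  rw [upper_zero]
  exact M.one_mem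

end Action

variable {K : Type*} [Field K] [CharP K 2]

/-- Cayley–Hamilton with determinant one: in characteristic two `h ^ 2 = 1` exactly if the trace
vanishes. -/
theorem sq_eq_one_iff (h : SL(2, K)) : h ^ 2 = 1 ↔ h.1 1 1 = h.1 0 0 := by
  have two : (2 : K) = 0 := CharTwo.two_eq_zero
  have hd := det_eq_one h
  constructor
  · intro h2
    have e := congrArg Subtype.val h2
    rw [sq, mul_entries] at e
    have e00 := congrFun (congrFun e 0) 0
    have e01 := congrFun (congrFun e 0) 1
    have e10 := congrFun (congrFun e 1) 0
    have e11 := congrFun (congrFun e 1) 1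
    simp at e00 e01 e10 e11
    by_contra hne
    have hs : h.1 0 0 + h.1 1 1 ≠ 0 := fun h0 => hne (by grind)
    have z01 : h.1 0 1 = 0 := by
      refine (mul_eq_zero.1 (?_ : (h.1 0 0 + h.1 1 1) * h.1 0 1 = 0)).resolve_left hs
      grind
    have z10 : h.1 1 0 = 0 := by
      refine (mul_eq_zero.1 (?_ : (h.1 0 0 + h.1 1 1) * h.1 1 0 = 0)).resolve_left hs
      grind
    have : (h.1 0 0 + 1) ^ 2 = 0 := by grind
    have h0 := pow_eq_zero_iff (two_ne_zero) |>.1 this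
    have : (h.1 1 1 + 1) ^ 2 = 0 := by grind
    have h0' := pow_eq_zero_iff (two_ne_zero) |>.1 this
    grind
  · intro ht
    rw [sq]
    apply ext_entries <;> rw [mul_entries] <;> simp <;> grind

/-- Fixed points are the roots of a quadratic whose linear coefficient is the trace, with `∞` as a
root if the lower left entry is 0. Trace zero makes it a square up to a scalar; nonzero trace makes
its roots distinct. -/
theorem fixesOneOrTwo [IsAlgClosed K] : FixesOneOrTwo SL(2, K) (OnePoint K) where
  one h h1 h2 := by
    have two : (2 : K) = 0 := CharTwo.two_eq_zero
    have ht := (sq_eq_one_iff h).1 h2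
    have hd := det_eq_one h
    by_cases hc : h.1 1 0 = 0
    · refine ⟨∞, (smul_infty_iff h).2 hc, fun x hx => ?_⟩
      cases x with
      | infty => rfl
      | coe z =>
        exfalso
        simp only [smul_coe_iff, hc, ht] at hx
        apply h1
        have : (h.1 0 0 + 1) ^ 2 = 0 := by grind
        have h0 := pow_eq_zero_iff (two_ne_zero) |>.1 this
        apply ext_entries <;> simp <;> grind
    · obtain ⟨z, hz⟩ := IsAlgClosed.exists_pow_nat_eq (h.1 0 1 / h.1 1 0) two_pos
      rw [eq_div_iff hc] at hz
      refine ⟨(z : OnePoint K), (smul_coe_iff h z).2 (by grind), fun x hx => ?_⟩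
      cases x with
      | infty => exact absurd ((smul_infty_iff h).1 hx) hc
      | coe y =>
        simp only [smul_coe_iff] at hx
        have : h.1 1 0 * (y + z) ^ 2 = 0 := by grind
        have := pow_eq_zero_iff (two_ne_zero) |>.1 ((mul_eq_zero.1 this).resolve_left hc)
        rw [coe_eq_coe]
        grind
  two h h2 := by
    have two : (2 : K) = 0 := CharTwo.two_eq_zero
    have h1 : h ≠ 1 := by rintro rfl; exact h2 (one_pow 2)
    have ht : h.1 1 1 + h.1 0 0 ≠ 0 := fun e => (sq_eq_one_iff h).not.1 h2 (by grind)
    by_cases hc : h.1 1 0 = 0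
    · refine ⟨∞, (h.1 0 1 / (h.1 1 1 + h.1 0 0) : K), infty_ne_coe _, fun x => ?_⟩
      cases x with
      | infty => simp [smul_infty_iff, hc]
      | coe z =>
        rw [smul_coe_iff, coe_eq_coe, eq_div_iff ht, hc]
        simp only [coe_ne_infty, false_or]
        grind
    · obtain ⟨z, hz⟩ := IsAlgClosed.exists_root
        (Polynomial.C (h.1 1 0) * Polynomial.X ^ 2 +
          Polynomial.C (h.1 1 1 + h.1 0 0) * Polynomial.X + Polynomial.C (h.1 0 1))
        (by rw [Polynomial.degree_quadratic hc]; decide)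
      simp only [Polynomial.IsRoot, Polynomial.eval_add, Polynomial.eval_mul, Polynomial.eval_C,
        Polynomial.eval_pow, Polynomial.eval_X] at hz
      refine ⟨(z : OnePoint K), (z + (h.1 1 1 + h.1 0 0) / h.1 1 0 : K), ?_, fun x => ?_⟩
      · rw [Ne, coe_eq_coe, left_eq_add, div_eq_zero_iff]
        tauto
      · cases x with
        | infty => simp [smul_infty_iff, hc, infty_ne_coe]
        | coe y =>
          rw [smul_coe_iff, coe_eq_coe, coe_eq_coe]
          have e : h.1 1 0 * y ^ 2 + (h.1 1 1 - h.1 0 0) * y - h.1 0 1 =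
              (y - z) * (h.1 1 0 * (y - z) + (h.1 1 1 + h.1 0 0)) := by grind
          rw [e, mul_eq_zero, sub_eq_zero, ← sub_eq_zero (b := z + _)]
          have e2 : h.1 1 0 * (y - z) + (h.1 1 1 + h.1 0 0) =
              h.1 1 0 * (y - (z + (h.1 1 1 + h.1 0 0) / h.1 1 0)) := by field_simp; grind
          rw [e2, mul_eq_zero]
          tauto

theorem fixesOneOrTwo_subgroup [IsAlgClosed K] (M : Subgroup SL(2, K)) :
    FixesOneOrTwo M (OnePoint K) where
  one h h1 h2 := fixesOneOrTwo.one h.1 (fun e => h1 (Subtype.ext e)) (congrArg Subtype.val h2)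
  two h h2 := fixesOneOrTwo.two h.1 fun e => h2 (Subtype.ext e)

/-- The matrix of `x ↦ 1 / x`. -/
def weyl : SL(2, K) := ⟨!![0, 1; 1, 0], by simp [Matrix.det_fin_two_of, CharTwo.neg_eq]⟩

theorem eq_upper_iff (h : SL(2, K)) :
    h • (∞ : OnePoint K) = ∞ ∧ h ^ 2 = 1 ↔ h = upper (h.1 0 1) := by
  have two : (2 : K) = 0 := CharTwo.two_eq_zero
  constructor
  · rintro ⟨hi, h2⟩
    rw [smul_infty_iff] at hi
    by_cases h1 : h = 1
    · rw [h1]; simp [upper_zero]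
    · have ht := (sq_eq_one_iff h).1 h2
      have hd := det_eq_one h
      have : (h.1 0 0 + 1) ^ 2 = 0 := by grind
      have h0 := pow_eq_zero_iff (two_ne_zero) |>.1 this
      apply ext_entries <;> simp [upper] <;> grind
  · intro h
    rw [h]
    refine ⟨(smul_infty_iff _).2 (by simp [upper]), ?_⟩
    rw [sq, upper_mul, CharTwo.add_self_eq_zero, upper_zero]

/-- The elements of square one in the stabilizer of `∞` are the unitriangular matrices. -/
def involutionEquiv (M : Subgroup SL(2, K)) :
    {h : M // h • (∞ : OnePoint K) = ∞ ∧ h ^ 2 = 1} ≃ {β : K | upper β ∈ M} where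
  toFun h := ⟨h.1.1.1 0 1, by
    have := (eq_upper_iff h.1.1).1 ⟨h.2.1, congrArg Subtype.val h.2.2⟩
    change upper _ ∈ M
    rw [← this]
    exact h.1.2⟩
  invFun β := ⟨⟨upper β.1, β.2⟩, by
    have := (eq_upper_iff (upper β.1)).2 rfl
    exact ⟨this.1, Subtype.ext this.2⟩⟩
  left_inv h := Subtype.ext (Subtype.ext
    ((eq_upper_iff h.1.1).1 ⟨h.2.1, congrArg Subtype.val h.2.2⟩).symm)
  right_inv β := rfl

/-- The upper left entry, as a character of the upper triangular matrices in `M`. -/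
def diagChar (M : Subgroup SL(2, K)) : stabilizer M (∞ : OnePoint K) →* K where
  toFun h := h.1.1.1 0 0
  map_one' := by simp
  map_mul' h k := by
    have : k.1.1.1 1 0 = 0 := (smul_infty_iff k.1.1).1 k.2
    change (h.1.1 * k.1.1).1 0 0 = _
    rw [mul_entries]
    simp [this]

theorem conj_upper (h : SL(2, K)) (hh : h.1 1 0 = 0) (β : K) :
    h * upper β * h⁻¹ = upper (h.1 0 0 ^ 2 * β) := by
  rw [mul_inv_eq_iff_eq_mul]
  have hd := det_eq_one h
  apply ext_entries <;> rw [mul_entries, mul_entries] <;> simp [upper, hh]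
  grind

theorem diagChar_ker (M : Subgroup SL(2, K)) (h : stabilizer M (∞ : OnePoint K)) :
    h ∈ (diagChar M).toHomUnits.ker ↔ h.1 • (∞ : OnePoint K) = ∞ ∧ h.1 ^ 2 = 1 := by
  have two : (2 : K) = 0 := CharTwo.two_eq_zero
  have hi : h.1.1.1 1 0 = 0 := (smul_infty_iff h.1.1).1 h.2
  have hd := det_eq_one h.1.1
  have e : h ∈ (diagChar M).toHomUnits.ker ↔ h.1.1.1 0 0 = 1 := by
    rw [MonoidHom.mem_ker, Units.ext_iff]
    rfl
  have e2 : h.1 ^ 2 = 1 ↔ h.1.1 ^ 2 = 1 := Subtype.ext_iff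
  have e3 := eq_upper_iff h.1.1
  have e4 : h.1 • (∞ : OnePoint K) = ∞ := h.2
  have e5 : h.1.1 • (∞ : OnePoint K) = ∞ := h.2
  rw [e, e2]
  constructor
  · intro h0
    refine ⟨e4, (e3.2 ?_).2⟩
    apply ext_entries <;> simp [upper] <;> grind
  · rintro ⟨-, h2⟩
    rw [e3.1 ⟨e5, h2⟩]
    rfl

/-- The nonzero squares `x ^ 2` with `x` on the diagonal of an upper triangular matrix in `M`. -/
def squareMap (M : Subgroup SL(2, K)) (h1 : upper 1 ∈ M) :
    (diagChar M).toHomUnits.range → ({β : K | upper β ∈ M} \ {0} : Set K) := fun x =>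
  ⟨(x.1 : K) ^ 2, by
    obtain ⟨_, h, rfl⟩ := x
    have := conj_upper h.1.1 ((smul_infty_iff h.1.1).1 h.2) 1
    rw [mul_one] at this
    change upper (h.1.1.1 0 0 ^ 2) ∈ M
    rw [← this]
    exact mul_mem (mul_mem h.1.2 h1) (inv_mem h.1.2), by
    simp⟩

theorem squareMap_injective (M : Subgroup SL(2, K)) (h1 : upper 1 ∈ M) :
    Function.Injective (squareMap M h1) := by
  intro x y e
  have two : (2 : K) = 0 := CharTwo.two_eq_zero
  have e' : (x.1 : K) ^ 2 = (y.1 : K) ^ 2 := congrArg Subtype.val e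
  have : ((x.1 : K) + y.1) ^ 2 = 0 := by grind
  have h0 := pow_eq_zero_iff (two_ne_zero) |>.1 this
  exact Subtype.ext (Units.ext (by grind))

/-- The kernel of the diagonal character is the unitriangular part of the stabilizer. -/
theorem card_stabilizer (M : Subgroup SL(2, K)) [Finite M] :
    Nat.card (stabilizer M (∞ : OnePoint K)) =
      Nat.card {β : K | upper β ∈ M} * Nat.card (diagChar M).toHomUnits.range := by
  rw [← Subgroup.card_mul_index (diagChar M).toHomUnits.ker, Subgroup.index_ker]
  congr 1
  rw [← Nat.card_congr (involutionEquiv M)]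
  refine Nat.card_congr ⟨fun h => ⟨h.1.1, (diagChar_ker M h.1).1 h.2⟩,
    fun h => ⟨⟨h.1, h.2.1⟩, (diagChar_ker M _).2 h.2⟩, fun _ => rfl, fun _ => rfl⟩

theorem orderThree_smul {M P : Type*} [Group M] [MulAction M P] [Finite M] {x : P}
    (hx : Nat.card (orbit M x) = 2) {h : M} (h3 : h ^ 3 = 1) : h • x = x := by
  by_contra hne
  have hmem : ∀ k : M, k • x = x ∨ k • x = h • x := by
    intro k
    rw [Nat.card_coe_set_eq, Set.ncard_eq_two] at hx
    obtain ⟨y, z, -, hyz⟩ := hx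
    have h0 : x ∈ ({y, z} : Set P) := hyz ▸ mem_orbit_self x
    have h1 : h • x ∈ ({y, z} : Set P) := hyz ▸ mem_orbit x h
    have h2 : k • x ∈ ({y, z} : Set P) := hyz ▸ mem_orbit x k
    simp only [Set.mem_insert_iff, Set.mem_singleton_iff] at h0 h1 h2
    grind
  rcases hmem (h * h) with e | e
  · have : h ^ 3 • x = x := by rw [h3, one_smul]
    rw [pow_succ', sq, mul_smul, e] at this
    exact hne this
  · rw [mul_smul, smul_left_cancel_iff] at e
    exact hne e

/-- A finite subgroup of `SL(2, K)` that contains `SL(2, 2)` and its conjugate by `upper α`,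
where `α ≠ 0, 1`, contains all `upper β` with `β` in some subfield that contains `α`. -/
theorem exists_subfield [IsAlgClosed K] (M : Subgroup SL(2, K)) [Finite M] (h1 : upper 1 ∈ M)
    (hw : weyl ∈ M) {α : K} (hα0 : α ≠ 0) (hα1 : α ≠ 1) (hα : upper α * weyl * upper α ∈ M) :
    ∃ U : Subfield K, α ∈ U ∧ ∀ β ∈ U, upper β ∈ M := by
  have two : (2 : K) = 0 := CharTwo.two_eq_zero
  have hfix := fixesOneOrTwo_subgroup M
  have hs := Nat.card_congr (involutionEquiv M)
  -- Conjugating `upper 1` by an element with upper left entry `x` gives `upper (x ^ 2)`, and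
  -- squaring is injective. This is the source of the bound `s * (s - 1)` required by
  -- `orbit_dichotomy`.
  have hle : Nat.card (diagChar M).toHomUnits.range ≤ Nat.card {β : K | upper β ∈ M} - 1 := by
    rw [← card_diff_zero]
    exact Nat.card_le_card_of_injective _ (squareMap_injective M h1)
  have hmem0 : (0 : K) ∈ {β : K | upper β ∈ M} := by
    change upper 0 ∈ M
    rw [upper_zero]
    exact M.one_mem
  have hw0 : weyl • (∞ : OnePoint K) = (0 : K) :=
    smul_infty_coe weyl 0 (by simp [weyl]) (by simp [weyl])
  have hup : ∀ β γ : K, upper β • (γ : OnePoint K) = (γ + β : K) := fun β γ =>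
    smul_coe_eq _ _ _ (by simp [upper]) (by simp [upper])
  have hp : 2 ≤ Nat.card {h : M // h • (∞ : OnePoint K) = ∞ ∧ h ^ 2 = 1} := by
    rw [hs]
    have : Nontrivial {β : K | upper β ∈ M} :=
      ⟨⟨0, hmem0⟩, ⟨1, h1⟩, fun e => zero_ne_one (congrArg Subtype.val e)⟩
    exact Finite.one_lt_card
  have hU : ∀ h h' : M, h • (∞ : OnePoint K) = ∞ → h' • (∞ : OnePoint K) = ∞ → h ^ 2 = 1 →
      h' ^ 2 = 1 → (h * h') ^ 2 = 1 := by
    intro h h' hi hi' h2 h2'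
    have e := (eq_upper_iff h.1).1 ⟨hi, congrArg Subtype.val h2⟩
    have e' := (eq_upper_iff h'.1).1 ⟨hi', congrArg Subtype.val h2'⟩
    apply Subtype.ext
    change (h.1 * h'.1) ^ 2 = 1
    rw [e, e', upper_mul]
    exact ((eq_upper_iff _).2 rfl).2
  have hk : (⟨weyl, hw⟩ : M) • (∞ : OnePoint K) ≠ ∞ := by
    change (weyl : SL(2, K)) • (∞ : OnePoint K) ≠ ∞
    rw [hw0]
    exact coe_ne_infty _
  have hst : Nat.card (stabilizer M (∞ : OnePoint K)) ≤
      Nat.card {h : M // h • (∞ : OnePoint K) = ∞ ∧ h ^ 2 = 1} *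
        (Nat.card {h : M // h • (∞ : OnePoint K) = ∞ ∧ h ^ 2 = 1} - 1) := by
    rw [hs, card_stabilizer]
    exact Nat.mul_le_mul_left _ hle
  rcases orbit_dichotomy hfix hp hU hk hst with ⟨x, hx⟩ | ⟨hN, hm⟩
  · exfalso
    have fix3 : ∀ h ∈ M, h ^ 3 = 1 → h • x = x := fun h hh h3 =>
      orderThree_smul hx (h := ⟨h, hh⟩) (Subtype.ext h3)
    -- An orbit of length two is fixed pointwise by elements of order three. The two elements used
    -- here are conjugate under `upper α`, so a common fixed point `z` makes `z` and `z + α` both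
    -- roots of `X ^ 2 + X + 1`, which forces `α * (α + 1) = 0`.
    have e1 := fix3 (upper 1 * weyl) (mul_mem h1 hw) (by
      rw [pow_succ, sq]
      apply ext_entries <;> simp only [mul_entries] <;> simp [upper, weyl] <;> grind)
    have e2 := fix3 (upper 1 * (upper α * weyl * upper α)) (mul_mem h1 hα) (by
      rw [pow_succ, sq]
      apply ext_entries <;> simp only [mul_entries] <;> simp [upper, weyl] <;> grind)
    cases x with
    | infty =>
      rw [smul_infty_iff, mul_entries] at e1
      simp [upper, weyl] at e1
    | coe z =>
      rw [smul_coe_iff] at e1 e2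
      simp only [mul_entries] at e1 e2
      simp [upper, weyl] at e1 e2
      have : α * (α + 1) = 0 := by grind
      rcases mul_eq_zero.1 this with h | h
      · exact hα0 h
      · exact hα1 (by grind)
  · rw [hs] at hN hm
    -- Equality in the order bound makes every nonzero `γ` with `upper γ ∈ M` the square of a
    -- diagonal entry. Multiplication by `γ` is then conjugation within `M`, which gives closure
    -- under products and inverses.
    have hsurj : Function.Surjective (squareMap M h1) := by
      refine ((Nat.bijective_iff_injective_and_card _).2
        ⟨squareMap_injective M h1, ?_⟩).surjective
      rw [card_diff_zero]
      rw [card_stabilizer] at hm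
      exact Nat.eq_of_mul_eq_mul_left (Nat.card_pos_iff.2 ⟨⟨⟨0, hmem0⟩⟩, inferInstance⟩) hm
    have hdiag : ∀ γ : K, upper γ ∈ M → γ ≠ 0 →
        ∃ h ∈ M, h.1 1 0 = 0 ∧ h.1 0 0 ^ 2 = γ := by
      intro γ hγ hγ0
      obtain ⟨⟨_, h, rfl⟩, hh⟩ := hsurj ⟨γ, hγ, hγ0⟩
      exact ⟨h.1.1, h.1.2, (smul_infty_iff h.1.1).1 h.2, congrArg Subtype.val hh⟩
    let U : Subfield K :=
      { carrier := {β : K | upper β ∈ M}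
        mul_mem' := by
          intro γ β hγ hβ
          rcases eq_or_ne γ 0 with rfl | hγ0
          · rw [zero_mul]; exact hmem0
          obtain ⟨h, hh, h10, rfl⟩ := hdiag γ hγ hγ0
          change upper _ ∈ M
          rw [← conj_upper h h10]
          exact mul_mem (mul_mem hh hβ) (inv_mem hh)
        one_mem' := h1
        add_mem' := by
          intro β γ hβ hγ
          change upper _ ∈ M
          rw [← upper_mul]
          exact mul_mem hβ hγ
        zero_mem' := hmem0
        neg_mem' := by
          intro β hβ
          rw [CharTwo.neg_eq]
          exact hβ
        inv_mem' := by
          intro γ hγ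
          rcases eq_or_ne γ 0 with rfl | hγ0
          · rw [inv_zero]; exact hmem0
          obtain ⟨h, hh, h10, rfl⟩ := hdiag γ hγ hγ0
          have e := conj_upper h h10 (h.1 0 0 ^ 2)⁻¹
          rw [mul_inv_cancel₀ hγ0, mul_inv_eq_iff_eq_mul, ← eq_inv_mul_iff_mul_eq] at e
          change upper _ ∈ M
          rw [e]
          exact mul_mem (inv_mem hh) (mul_mem h1 hh) }
    refine ⟨U, ?_, fun β hβ => hβ⟩
    -- The orbit has `s + 1` points, so it consists of `∞` and the elements of `U`.
    let j : Option {β : K | upper β ∈ M} → orbit M (∞ : OnePoint K) := fun o => o.elim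
      ⟨∞, mem_orbit_self _⟩ fun β => ⟨(β.1 : OnePoint K), by
        refine ⟨⟨upper β.1 * weyl, mul_mem β.2 hw⟩, ?_⟩
        change (upper β.1 * weyl) • (∞ : OnePoint K) = _
        rw [mul_smul, hw0, hup, zero_add]⟩
    have hj : Function.Injective j := by
      rintro (_ | ⟨β, hβ⟩) (_ | ⟨γ, hγ⟩) e
      · rfl
      · exact absurd (congrArg Subtype.val e) (infty_ne_coe _)
      · exact absurd (congrArg Subtype.val e) (coe_ne_infty _)
      · have : β = γ := coe_eq_coe.1 (congrArg Subtype.val e)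
        subst this
        rfl
    have hjs : Function.Surjective j := by
      refine ((Nat.bijective_iff_injective_and_card j).2 ⟨hj, ?_⟩).surjective
      rw [Finite.card_option, hN]
    obtain ⟨o, ho⟩ := hjs ⟨(α : OnePoint K), ⟨upper α * weyl * upper α, hα⟩, by
      change (upper α * weyl * upper α) • (∞ : OnePoint K) = α
      have : upper α • (∞ : OnePoint K) = ∞ := ((eq_upper_iff _).2 rfl).1
      rw [mul_smul, this, mul_smul, hw0, hup, zero_add]⟩
    rcases o with _ | β
    · exact absurd (congrArg Subtype.val ho) (infty_ne_coe _)
    · have : (β : K) = α := coe_eq_coe.1 (congrArg Subtype.val ho)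
      rw [← this]
      exact β.2

end CharTwoSL

/-! ### Generation of `SL(2, K)` and its endomorphisms. -/

namespace CharTwoSL

variable {K : Type*} [Field K]

theorem map_upper {L : Type*} [Field L] (i : K →+* L) (β : K) :
    Matrix.SpecialLinearGroup.map i (upper β) = upper (i β) :=
  ext_entries (map_one i) rfl (map_zero i) (map_one i)

theorem map_weyl {L : Type*} [Field L] [CharP K 2] [CharP L 2] (i : K →+* L) :
    Matrix.SpecialLinearGroup.map i (weyl : SL(2, K)) = weyl :=
  ext_entries (map_zero i) (map_one i) (map_one i) (map_zero i)

/-- A matrix with nonzero lower left entry is a product upper–lower–upper of unitriangular matrices,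
the lower one being a conjugate of an upper one by `weyl`. Otherwise multiply by `weyl` first. -/
theorem mem_of_upper_of_weyl [CharP K 2] (S : Subgroup SL(2, K)) (hu : ∀ β, upper β ∈ S)
    (hw : weyl ∈ S) (h : SL(2, K)) : h ∈ S := by
  have two : (2 : K) = 0 := CharTwo.two_eq_zero
  have key : ∀ h : SL(2, K), h.1 1 0 ≠ 0 → h ∈ S := by
    intro h hc
    have hd := det_eq_one h
    have e : h = upper ((h.1 0 0 + 1) / h.1 1 0) * (weyl * upper (h.1 1 0) * weyl) *
        upper ((h.1 1 1 + 1) / h.1 1 0) := by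
      apply ext_entries <;> simp only [mul_entries] <;> simp [upper, weyl] <;> field_simp <;> grind
    rw [e]
    exact mul_mem (mul_mem (hu _) (mul_mem (mul_mem hw (hu _)) hw)) (hu _)
  by_cases hc : h.1 1 0 = 0
  · have hd := det_eq_one h
    have : h = weyl * (weyl * h) := by
      apply ext_entries <;> simp only [mul_entries] <;> simp [weyl]
    rw [this]
    refine mul_mem hw (key _ ?_)
    simp only [mul_entries]
    simp [weyl]
    intro h0
    simp [hc, h0] at hd
  · exact key h hc

/-- Over a finite field, `SL(2, 2)` and its conjugate by `upper α` generate `SL(2, K)` if `α`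
generates `K`. -/
theorem eq_top_of_generator [CharP K 2] [Finite K] {α : K}
    (hα : Subfield.closure {α} = (⊤ : Subfield K)) (hα0 : α ≠ 0) (hα1 : α ≠ 1)
    (S : Subgroup SL(2, K)) (h1 : upper 1 ∈ S) (hw : weyl ∈ S)
    (hc : upper α * weyl * upper α ∈ S) : S = ⊤ := by
  let i := algebraMap K (AlgebraicClosure K)
  have : CharP (AlgebraicClosure K) 2 := charP_of_injective_algebraMap i.injective 2
  let m : SL(2, K) →* SL(2, AlgebraicClosure K) := Matrix.SpecialLinearGroup.map i
  have hm : Function.Injective m := by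
    intro h k e
    apply Subtype.ext
    ext a b
    exact i.injective (congrFun (congrFun (congrArg Subtype.val e) a) b)
  have : Finite (S.map m) := (Set.toFinite (S : Set SL(2, K))).image m
  obtain ⟨U, hαU, hU⟩ := exists_subfield (S.map m) (α := i α) ⟨_, h1, by rw [map_upper, map_one]⟩
    ⟨_, hw, map_weyl i⟩
    ((map_ne_zero i).2 hα0) (fun e => hα1 (i.injective (e.trans (map_one i).symm)))
    ⟨_, hc, by rw [map_mul, map_mul, map_upper, map_weyl]⟩
  rw [eq_top_iff]
  intro h _
  refine mem_of_upper_of_weyl S (fun β => ?_) hw h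
  have hβ : β ∈ U.comap i := by
    have : Subfield.closure {α} ≤ U.comap i :=
      Subfield.closure_le.2 (Set.singleton_subset_iff.2 hαU)
    rw [hα] at this
    exact this (Subfield.mem_top β)
  obtain ⟨k, hk, e⟩ := hU _ hβ
  rw [← map_upper] at e
  rwa [← hm e]

/-- An endomorphism of `SL(2, K)` that fixes `upper 1` is given on the upper unitriangular
matrices by an endomorphism of `K`. -/
theorem exists_ringHom [CharP K 2] [PerfectRing K 2] (σ : SL(2, K) →* SL(2, K))
    (h1 : σ (upper 1) = upper 1) : ∃ φ : K →+* K, ∀ β, σ (upper β) = upper (φ β) := by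
  have two : (2 : K) = 0 := CharTwo.two_eq_zero
  -- The image of `upper β` commutes with `upper 1`, whose centralizer is the unitriangular group.
  have hex : ∀ β : K, ∃ γ : K, σ (upper β) = upper γ := by
    intro β
    have e : σ (upper β) * upper 1 = upper 1 * σ (upper β) := by
      rw [← h1, ← map_mul, ← map_mul, upper_mul, upper_mul, add_comm]
    have hd := det_eq_one (σ (upper β))
    have e' := congrArg Subtype.val e
    rw [mul_entries, mul_entries] at e'
    have e00 := congrFun (congrFun e' 0) 0
    have e01 := congrFun (congrFun e' 0) 1
    simp [upper] at e00 e01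
    change _ = _ at e01
    refine ⟨(σ (upper β)).1 0 1, ?_⟩
    have : ((σ (upper β)).1 0 0 + 1) ^ 2 = 0 := by
      simp only [upper] at hd ⊢
      grind
    have h0 := pow_eq_zero_iff (two_ne_zero) |>.1 this
    apply ext_entries <;> simp only [upper] at h0 hd ⊢ <;> simp <;> grind
  choose φ hφ using hex
  have hone : φ 1 = 1 := upper_injective ((hφ 1).symm.trans h1)
  have hadd : ∀ x y, φ (x + y) = φ x + φ y := fun x y => upper_injective (by
    rw [← hφ, ← upper_mul, map_mul, hφ, hφ, upper_mul])
  have hmul : ∀ x y, φ (x * y) = φ x * φ y := by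
    intro z y
    -- Multiplication by a square is conjugation by a diagonal matrix `d`, and in a perfect field
    -- every element is a square. The image of `d` is upper triangular because it conjugates `upper
    -- 1` to a unitriangular matrix.
    obtain ⟨x, rfl⟩ : ∃ x, x ^ 2 = z := surjective_frobenius K 2 z
    rcases eq_or_ne x 0 with rfl | hx
    · have : φ 0 = 0 := by simpa using hadd 0 0
      simp [this]
    let d : SL(2, K) := ⟨!![x, 0; 0, x⁻¹], by simp [hx]⟩
    have hd : ∀ β, d * upper β * d⁻¹ = upper (x ^ 2 * β) := fun β =>
      conj_upper d (by simp [d]) β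
    have hσ : ∀ β, σ d * upper (φ β) * (σ d)⁻¹ = upper (φ (x ^ 2 * β)) := fun β => by
      rw [← hφ, ← hφ, ← hd, map_mul, map_mul, map_inv]
    have h10 : (σ d).1 1 0 = 0 := by
      have e := hσ 1
      rw [mul_inv_eq_iff_eq_mul, hone] at e
      have e' := congrArg Subtype.val e
      rw [mul_entries, mul_entries] at e'
      have e11 := congrFun (congrFun e' 1) 1
      simpa [upper] using e11
    have hD : ∀ β, φ (x ^ 2 * β) = (σ d).1 0 0 ^ 2 * φ β := fun β => upper_injective (by
      rw [← hσ, conj_upper _ h10])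
    have hD1 := hD 1
    rw [mul_one, hone, mul_one] at hD1
    rw [hD, hD1]
  exact ⟨⟨⟨⟨φ, hone⟩, hmul⟩, by simpa using hadd 0 0, hadd⟩, hφ⟩

/-- The upper left entry of `upper x * weyl * upper x` is `x`, so `φ x` can be read off there. -/
theorem map_eq_of_hom [CharP K 2] [PerfectRing K 2] (σ : SL(2, K) →* SL(2, K))
    (h1 : σ (upper 1) = upper 1) (hw : σ weyl = weyl) {x y : K}
    (hxy : σ (upper x * weyl * upper x) = upper y * weyl * upper y) :
    ∃ φ : K →+* K, φ x = y := by
  obtain ⟨φ, hφ⟩ := exists_ringHom σ h1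
  refine ⟨φ, ?_⟩
  rw [map_mul, map_mul, hφ, hw] at hxy
  have e := congrFun (congrFun (congrArg Subtype.val hxy) 0) 0
  simp only [mul_entries] at e
  simpa [upper, weyl] using e

end CharTwoSL

/-! ### Generators of the finite field and powers of Frobenius. -/

section Generator

variable {f : ℕ} {α : GaloisField 2 f}

theorem exists_sq_ne_self (hf : 2 ≤ f) : ∃ x : GaloisField 2 f, x ^ 2 ≠ x := by
  by_contra! h
  have hcard : Nat.card (GaloisField 2 f) = 2 ^ f := GaloisField.card 2 f (by omega)
  have : (2 : ℕ) ^ 2 ≤ 2 ^ f := Nat.pow_le_pow_right two_pos hf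
  have hle : Nat.card (GaloisField 2 f) ≤ Nat.card (ZMod 2) := by
    refine Nat.card_le_card_of_surjective (algebraMap (ZMod 2) (GaloisField 2 f)) fun x => ?_
    have h0 : x * (x - 1) = 0 := by rw [mul_sub, ← sq, h, mul_one, sub_self]
    rcases mul_eq_zero.1 h0 with h0 | h0
    · exact ⟨0, by rw [h0, map_zero]⟩
    · exact ⟨1, by rw [sub_eq_zero.1 h0, map_one]⟩
  rw [Nat.card_zmod, hcard] at hle
  omega

theorem generator_sq_ne_self (hf : 2 ≤ f)
    (hα : Subfield.closure {α} = (⊤ : Subfield (GaloisField 2 f))) : α ^ 2 ≠ α := by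
  intro h
  obtain ⟨x, hx⟩ := exists_sq_ne_self hf
  have e : frobenius (GaloisField 2 f) 2 = RingHom.id _ :=
    RingHom.eq_of_eqOn_of_field_closure_eq_top hα (by simpa [Set.EqOn, frobenius_def] using h)
  exact hx (RingHom.congr_fun e x)

theorem exists_pow_eq_ringHom (hf : f ≠ 0) (φ : GaloisField 2 f →+* GaloisField 2 f) :
    ∃ n < f, ∀ x, φ x = x ^ 2 ^ n := by
  let φ' : GaloisField 2 f →ₐ[ZMod 2] GaloisField 2 f := ⟨φ, RingHom.congr_fun
    (Subsingleton.elim (φ.comp (algebraMap (ZMod 2) _)) (algebraMap (ZMod 2) _))⟩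
  obtain ⟨n, hn⟩ := (FiniteField.bijective_frobeniusAlgHom_pow (ZMod 2) (GaloisField 2 f)).2 φ'
  refine ⟨n, n.2.trans_eq (GaloisField.finrank 2 hf), fun x => ?_⟩
  have e : φ x = (FiniteField.frobeniusAlgHom (ZMod 2) (GaloisField 2 f) ^ n.1) x :=
    (DFunLike.congr_fun hn x).symm
  rw [e, AlgHom.coe_pow, FiniteField.coe_frobeniusAlgHom, ZMod.card, pow_iterate]

/-- Adding 1 twice is trivial, so `φ ∘ φ` fixes the generator and is the identity. With `φ` the
`n`-th power of Frobenius and `0 < n < f`, the order `f` of Frobenius divides `2 * n`, so `2 * n =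
f`. -/
theorem even_of_map_eq_add_one (hf : 2 ≤ f)
    (hα : Subfield.closure {α} = (⊤ : Subfield (GaloisField 2 f)))
    (φ : GaloisField 2 f →+* GaloisField 2 f) (hφ : φ α = α + 1) :
    Even f ∧ α ^ 2 ^ (f / 2) = α + 1 := by
  obtain ⟨n, hn, hφn⟩ := exists_pow_eq_ringHom (by omega) φ
  have h2 : φ.comp φ = RingHom.id _ :=
    RingHom.eq_of_eqOn_of_field_closure_eq_top hα (by
      simp [hφ, add_assoc, CharTwo.add_self_eq_zero])
  have h3 : FiniteField.frobeniusAlgHom (ZMod 2) (GaloisField 2 f) ^ (2 * n) = 1 := by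
    apply AlgHom.ext
    intro x
    have := RingHom.congr_fun h2 x
    rw [RingHom.comp_apply, hφn, hφn, ← pow_mul, ← pow_add, ← two_mul] at this
    rw [AlgHom.coe_pow, FiniteField.coe_frobeniusAlgHom, ZMod.card, pow_iterate]
    exact this
  obtain ⟨k, hk⟩ : f ∣ 2 * n := by
    rw [← GaloisField.finrank 2 (show f ≠ 0 by omega), ← FiniteField.orderOf_frobeniusAlgHom]
    exact orderOf_dvd_of_pow_eq_one h3
  have hn0 : n ≠ 0 := by
    rintro rfl
    have := hφn α
    rw [hφ] at this
    simp at this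
  have hk1 : k = 1 := by
    have : k < 2 := by
      by_contra! h
      nlinarith
    interval_cases k
    · omega
    · rfl
  subst hk1
  have hfn : f / 2 = n := by omega
  refine ⟨⟨n, by omega⟩, ?_⟩
  rw [hfn, ← hφn, hφ]

end Generator

/-! ### Connected components of coset graphs. -/

section CosetGraph

variable {G : Type*} [Group G] {L : Subgroup G} {g : G}
  {hs : DoubleCoset.doubleCoset g (L : Set G) L = DoubleCoset.doubleCoset g⁻¹ (L : Set G) L}
  {hg : g ∉ L}

theorem rightRel_mk_eq_iff (L : Subgroup G) {x y : G} :
    (Quotient.mk _ x : Quotient (QuotientGroup.rightRel L)) = Quotient.mk _ y ↔ y * x⁻¹ ∈ L :=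
  Quotient.eq.trans QuotientGroup.rightRel_apply

theorem cosetGraph_adj_mk {x y : G} :
    (cosetGraph L g hs hg).Adj (Quotient.mk _ x) (Quotient.mk _ y) ↔
      y * x⁻¹ ∈ DoubleCoset.doubleCoset g (L : Set G) L := by
  refine ⟨?_, fun h => ⟨x, y, rfl, rfl, h⟩⟩
  rintro ⟨x', y', hx, hy, h⟩
  rw [rightRel_mk_eq_iff] at hx hy
  obtain ⟨l, hl, l', hl', e⟩ := DoubleCoset.mem_doubleCoset.1 h
  refine DoubleCoset.mem_doubleCoset.2
    ⟨(y' * y⁻¹)⁻¹ * l, mul_mem (inv_mem hy) hl, l' * (x' * x⁻¹), mul_mem hl' hx, ?_⟩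
  calc y * x⁻¹ = (y' * y⁻¹)⁻¹ * (y' * x'⁻¹) * (x' * x⁻¹) := by group
    _ = _ := by rw [e]; group

/-- Each edge multiplies a representative on the left by an element of `LgL`; inverses of `g` cost
nothing because reachability is symmetric. -/
theorem cosetGraph_reachable_mk {x y : G} :
    (cosetGraph L g hs hg).Reachable (Quotient.mk _ x) (Quotient.mk _ y) ↔
      y * x⁻¹ ∈ Subgroup.closure ((L : Set G) ∪ {g}) := by
  constructor
  · rintro ⟨p⟩
    generalize hv : (Quotient.mk _ x : Quotient (QuotientGroup.rightRel L)) = v at p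
    generalize hw : (Quotient.mk _ y : Quotient (QuotientGroup.rightRel L)) = w at p
    induction p generalizing x with
    | nil => exact Subgroup.subset_closure (.inl ((rightRel_mk_eq_iff L).1 (hv.trans hw.symm)))
    | cons h p ih =>
      rename_i v z w
      obtain ⟨z, rfl⟩ := Quotient.exists_rep z
      rw [← hv, cosetGraph_adj_mk] at h
      obtain ⟨l, hl, l', hl', e⟩ := DoubleCoset.mem_doubleCoset.1 h
      have e' : y * x⁻¹ = y * z⁻¹ * (z * x⁻¹) := by group
      rw [e', e]
      exact mul_mem (ih rfl hw) (mul_mem (mul_mem (Subgroup.subset_closure (.inl hl))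
        (Subgroup.subset_closure (.inr rfl))) (Subgroup.subset_closure (.inl hl')))
  · intro h
    have key : ∀ z ∈ Subgroup.closure ((L : Set G) ∪ {g}), ∀ x : G,
        (cosetGraph L g hs hg).Reachable (Quotient.mk _ x) (Quotient.mk _ (z * x)) := by
      intro z hz
      induction hz using Subgroup.closure_induction with
      | mem z hz =>
        intro x
        rcases hz with hz | rfl
        · have e : (Quotient.mk _ x : Quotient (QuotientGroup.rightRel L)) = Quotient.mk _ (z * x) :=
            (rightRel_mk_eq_iff L).2 (by simpa using hz)
          rw [e]
        · refine SimpleGraph.Adj.reachable (cosetGraph_adj_mk.2 ?_)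
          rw [mul_inv_cancel_right]
          exact DoubleCoset.mem_doubleCoset_self L L z
      | one => intro x; rw [one_mul]
      | mul z w _ _ ihz ihw =>
        intro x
        rw [mul_assoc]
        exact (ihw x).trans (ihz (w * x))
      | inv z _ ih =>
        intro x
        have := ih (z⁻¹ * x)
        rw [mul_inv_cancel_left] at this
        exact this.symm
    have := key _ h x
    rwa [inv_mul_cancel_right] at this

theorem cosetGraph_connected (h : Subgroup.closure ((L : Set G) ∪ {g}) = ⊤) :
    (cosetGraph L g hs hg).Connected := by
  have : Nonempty (Quotient (QuotientGroup.rightRel L)) := ⟨Quotient.mk _ 1⟩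
  refine ⟨fun v w => ?_⟩
  obtain ⟨x, rfl⟩ := Quotient.exists_rep v
  obtain ⟨y, rfl⟩ := Quotient.exists_rep w
  rw [cosetGraph_reachable_mk, h]
  exact Subgroup.mem_top _

theorem card_connectedComponent_cosetGraph :
    Nat.card (cosetGraph L g hs hg).ConnectedComponent =
      (Subgroup.closure ((L : Set G) ∪ {g})).index := by
  rw [Subgroup.index_eq_card, ← Nat.card_congr
    (QuotientGroup.quotientRightRelEquivQuotientLeftRel (Subgroup.closure ((L : Set G) ∪ {g})))]
  symm
  refine Nat.card_congr (Equiv.ofBijective (Quotient.lift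
    (fun x => (cosetGraph L g hs hg).connectedComponentMk (Quotient.mk _ x)) fun x y h =>
      SimpleGraph.ConnectedComponent.eq.2 (cosetGraph_reachable_mk.2
        (QuotientGroup.rightRel_apply.1 h))) ⟨?_, ?_⟩)
  · intro v w h
    obtain ⟨x, rfl⟩ := Quotient.exists_rep v
    obtain ⟨y, rfl⟩ := Quotient.exists_rep w
    exact (rightRel_mk_eq_iff _).2
      (cosetGraph_reachable_mk.1 (SimpleGraph.ConnectedComponent.eq.1 h))
  · intro C
    induction C using SimpleGraph.ConnectedComponent.ind with
    | _ v =>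
      obtain ⟨x, rfl⟩ := Quotient.exists_rep v
      exact ⟨Quotient.mk _ x, rfl⟩

section Component

variable {K : Type*} [Group K] {H : Subgroup K} {k : K} {X : Subgroup G} (θ : X ≃* K)

/-- All of `L` and `g` lie in `X`, so the factors of an element of `LgL` can be carried through `θ`.
-/
theorem mem_doubleCoset_iff (hX : Subgroup.closure ((L : Set G) ∪ {g}) = X)
    (hL : ∀ x : X, θ x ∈ H ↔ (x : G) ∈ L) (hk : ∀ h : g ∈ X, θ ⟨g, h⟩ = k) (z : X) :
    (z : G) ∈ DoubleCoset.doubleCoset g (L : Set G) L ↔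
      θ z ∈ DoubleCoset.doubleCoset k (H : Set K) H := by
  have hgX : g ∈ X := hX ▸ Subgroup.subset_closure (.inr rfl)
  have hLX : ∀ l ∈ L, l ∈ X := fun l hl => hX ▸ Subgroup.subset_closure (.inl hl)
  simp only [DoubleCoset.mem_doubleCoset]
  constructor
  · rintro ⟨l, hl, l', hl', e⟩
    refine ⟨θ ⟨l, hLX l hl⟩, (hL _).2 hl, θ ⟨l', hLX l' hl'⟩, (hL _).2 hl', ?_⟩
    rw [← hk hgX, ← map_mul, ← map_mul]
    exact congrArg θ (Subtype.ext e)
  · rintro ⟨h, hh, h', hh', e⟩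
    obtain ⟨l, rfl⟩ := θ.surjective h
    obtain ⟨l', rfl⟩ := θ.surjective h'
    refine ⟨l, (hL _).1 hh, l', (hL _).1 hh', ?_⟩
    rw [← hk hgX, ← map_mul, ← map_mul] at e
    exact congrArg Subtype.val (θ.injective e)

theorem doubleCoset_eq_inv_of_equiv (hX : Subgroup.closure ((L : Set G) ∪ {g}) = X)
    (hL : ∀ x : X, θ x ∈ H ↔ (x : G) ∈ L) (hk : ∀ h : g ∈ X, θ ⟨g, h⟩ = k)
    (hs : DoubleCoset.doubleCoset g (L : Set G) L = DoubleCoset.doubleCoset g⁻¹ (L : Set G) L) :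
    DoubleCoset.doubleCoset k (H : Set K) H = DoubleCoset.doubleCoset k⁻¹ (H : Set K) H := by
  have hgX : g ∈ X := hX ▸ Subgroup.subset_closure (.inr rfl)
  refine (DoubleCoset.doubleCoset_eq_of_mem ?_).symm
  rw [← hk hgX, ← map_inv, hk hgX, ← mem_doubleCoset_iff θ hX hL hk, hs]
  exact DoubleCoset.mem_doubleCoset_self L L g⁻¹

variable {hs' : DoubleCoset.doubleCoset k (H : Set K) H = DoubleCoset.doubleCoset k⁻¹ (H : Set K) H}
  {hg' : k ∉ H}

/-- A connected component of the coset graph of `G` is isomorphic to the coset graph of the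
subgroup `X` that is generated by `L` and `g`. -/
theorem nonempty_component_iso (hX : Subgroup.closure ((L : Set G) ∪ {g}) = X)
    (hL : ∀ x : X, θ x ∈ H ↔ (x : G) ∈ L) (hk : ∀ h : g ∈ X, θ ⟨g, h⟩ = k)
    (C : (cosetGraph L g hs hg).ConnectedComponent) :
    Nonempty (C.toSimpleGraph ≃g cosetGraph H k hs' hg') := by
  induction C using SimpleGraph.ConnectedComponent.ind with
  | _ v =>
  obtain ⟨x, rfl⟩ := Quotient.exists_rep v
  have hq : ∀ a b : K, ((θ.symm b * θ.symm a⁻¹ : X) : G) = θ.symm b * x * (θ.symm a * x)⁻¹ := by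
    intro a b
    rw [map_inv]
    push_cast
    group
  have hθ : ∀ a b : K, θ (θ.symm b * θ.symm a⁻¹) = b * a⁻¹ := by
    intro a b
    rw [← map_mul, MulEquiv.apply_symm_apply]
  have hrel : ∀ a b : K, b * a⁻¹ ∈ H ↔ (θ.symm b * x * (θ.symm a * x)⁻¹ : G) ∈ L := by
    intro a b
    rw [← hq, ← hL, hθ]
  -- Right translation by `x` carries the component of the trivial coset to the given one.
  let F : Quotient (QuotientGroup.rightRel H) →
      ((cosetGraph L g hs hg).connectedComponentMk (Quotient.mk _ x)) :=
    Quotient.lift (fun a => ⟨Quotient.mk _ (θ.symm a * x : G),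
      SimpleGraph.ConnectedComponent.eq.2 (SimpleGraph.Reachable.symm
        (cosetGraph_reachable_mk.2 (by
          rw [mul_inv_cancel_right, hX]; exact (θ.symm a).2)))⟩)
      fun a b h => Subtype.ext ((rightRel_mk_eq_iff L).2
        ((hrel a b).1 (QuotientGroup.rightRel_apply.1 h)))
  have hF : Function.Bijective F := by
    constructor
    · intro v w h
      obtain ⟨a, rfl⟩ := Quotient.exists_rep v
      obtain ⟨b, rfl⟩ := Quotient.exists_rep w
      exact (rightRel_mk_eq_iff H).2
        ((hrel a b).2 ((rightRel_mk_eq_iff L).1 (congrArg Subtype.val h)))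
    · rintro ⟨v, hv⟩
      obtain ⟨y, rfl⟩ := Quotient.exists_rep v
      have h := cosetGraph_reachable_mk.1 (SimpleGraph.ConnectedComponent.eq.1 hv).symm
      rw [hX] at h
      refine ⟨Quotient.mk _ (θ ⟨_, h⟩), Subtype.ext ?_⟩
      change Quotient.mk _ ((θ.symm (θ ⟨_, h⟩) : G) * x) = _
      rw [MulEquiv.symm_apply_apply]
      change Quotient.mk _ (y * x⁻¹ * x) = _
      rw [inv_mul_cancel_right]
  refine ⟨SimpleGraph.Iso.symm ⟨Equiv.ofBijective F hF, ?_⟩⟩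
  intro v w
  obtain ⟨a, rfl⟩ := Quotient.exists_rep v
  obtain ⟨b, rfl⟩ := Quotient.exists_rep w
  refine (cosetGraph_adj_mk (hs := hs) (hg := hg)).trans (Iff.trans ?_ cosetGraph_adj_mk.symm)
  rw [← hq, mem_doubleCoset_iff θ hX hL hk, hθ]

end Component

end CosetGraph

/-! ### Goursat's lemma and trivial centralizers. -/

/-- A subgroup of `T × T` with surjective projections, where `T` is simple, is the whole group or
is contained in the graph of an endomorphism. -/
theorem Subgroup.eq_top_or_exists_hom {T : Type*} [Group T] [IsSimpleGroup T]
    (N : Subgroup (T × T)) (h1 : ∀ x, ∃ y, (x, y) ∈ N) (h2 : ∀ y, ∃ x, (x, y) ∈ N) :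
    N = ⊤ ∨ ∃ σ : T →* T, ∀ x y, (x, y) ∈ N → σ x = y := by
  -- The elements `y` with `(1, y) ∈ N` form a normal subgroup. If it is trivial, second coordinates
  -- are determined by first ones; if it is everything, so is `N`.
  have hn : N.goursatSnd.Normal := Subgroup.normal_goursatSnd fun y => by
    obtain ⟨x, hx⟩ := h2 y
    exact ⟨⟨_, hx⟩, rfl⟩
  rcases hn.eq_bot_or_eq_top with h | h
  · right
    have huniq : ∀ x y z, (x, y) ∈ N → (x, z) ∈ N → y = z := by
      intro x y z hy hz
      have : y * z⁻¹ ∈ N.goursatSnd := by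
        rw [Subgroup.mem_goursatSnd]
        simpa using mul_mem hy (inv_mem hz)
      rw [h, Subgroup.mem_bot] at this
      exact mul_inv_eq_one.1 this
    choose σ hσ using h1
    refine ⟨MonoidHom.mk' σ fun x y => ?_, fun x y hxy => huniq x _ _ (hσ x) hxy⟩
    exact huniq _ _ _ (hσ (x * y)) (by simpa using mul_mem (hσ x) (hσ y))
  · left
    rw [eq_top_iff]
    rintro ⟨x, y⟩ -
    obtain ⟨z, hz⟩ := h1 x
    have : (1, z⁻¹ * y) ∈ N := by
      rw [← Subgroup.mem_goursatSnd, h]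
      exact Subgroup.mem_top _
    simpa using mul_mem hz this

namespace CharTwoSL

variable {K : Type*} [Field K] [CharP K 2]

theorem eq_one_of_commute (h : SL(2, K)) (h1 : h * upper 1 = upper 1 * h)
    (hw : h * weyl = weyl * h) : h = 1 := by
  have two : (2 : K) = 0 := CharTwo.two_eq_zero
  have hd := det_eq_one h
  have e1 := congrArg Subtype.val h1
  have ew := congrArg Subtype.val hw
  rw [mul_entries, mul_entries] at e1 ew
  have e00 := congrFun (congrFun e1 0) 0
  have e01 := congrFun (congrFun e1 0) 1
  have w00 := congrFun (congrFun ew 0) 0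
  simp [upper, weyl] at e00 e01 w00
  have : (h.1 0 0 + 1) ^ 2 = 0 := by grind
  have h0 := pow_eq_zero_iff (two_ne_zero) |>.1 this
  apply ext_entries <;> simp <;> grind

theorem mk_injective : Function.Injective
    (QuotientGroup.mk' (Subgroup.center SL(2, K))) := by
  rw [injective_iff_map_eq_one]
  intro h hh
  have hc := Subgroup.mem_center_iff.1 ((QuotientGroup.eq_one_iff h).1 hh)
  exact eq_one_of_commute h (hc _).symm (hc _).symm

end CharTwoSL

/-! ### The subgroup generated by `L` and `g_α`. -/

namespace TwoArcFamily

open CharTwoSL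

variable {f : ℕ}

/-- In characteristic two, `SL(2)` and `PSL(2)` are isomorphic. -/
noncomputable def slEquiv (f : ℕ) : SL(2, GaloisField 2 f) ≃* T f :=
  MulEquiv.ofBijective (QuotientGroup.mk' _) ⟨mk_injective, QuotientGroup.mk'_surjective _⟩

theorem slEquiv_upper (β : GaloisField 2 f) : slEquiv f (upper β) = u β := rfl

/-- The element `x ↦ 1 / x` of `T`. -/
noncomputable def w (f : ℕ) : T f := slEquiv f weyl

theorem a_eq : a f = b f * w f := by
  rw [b, ← slEquiv_upper, w, ← map_mul]
  refine congrArg (slEquiv f) (ext_entries ?_ ?_ ?_ ?_) <;> simp only [mul_entries] <;>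
    simp [upper, weyl]

/-- The embedding of `SL(2, 2)` into `T` with image `H`. -/
noncomputable def primeHom (f : ℕ) : SL(2, ZMod 2) →* T f :=
  (QuotientGroup.mk' (Subgroup.center SL(2, GaloisField 2 f))).comp
    (Matrix.SpecialLinearGroup.map (algebraMap (ZMod 2) (GaloisField 2 f)))

theorem primeHom_upper : primeHom f (upper 1) = b f := by
  have := map_upper (algebraMap (ZMod 2) (GaloisField 2 f)) 1
  rw [map_one] at this
  exact congrArg (slEquiv f) this

theorem primeHom_weyl : primeHom f weyl = w f :=
  congrArg (slEquiv f) (map_weyl (algebraMap (ZMod 2) (GaloisField 2 f)))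

theorem closure_eq_top_zmod : Subgroup.closure {upper 1, weyl} = (⊤ : Subgroup SL(2, ZMod 2)) := by
  rw [eq_top_iff]
  intro h _
  refine mem_of_upper_of_weyl _ (fun β => ?_) (Subgroup.subset_closure (by simp)) h
  have : β = 0 ∨ β = 1 := by revert β; decide
  rcases this with rfl | rfl
  · rw [upper_zero]; exact one_mem _
  · exact Subgroup.subset_closure (by simp)

theorem H_eq_closure : H f = Subgroup.closure {b f, w f} := by
  have : H f = (primeHom f).range := rfl
  rw [this, MonoidHom.range_eq_map, ← closure_eq_top_zmod, MonoidHom.map_closure, Set.image_pair,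
    primeHom_upper, primeHom_weyl]

theorem b_mem_H : b f ∈ H f := by
  rw [H_eq_closure]; exact Subgroup.subset_closure (by simp)

theorem w_mem_H : w f ∈ H f := by
  rw [H_eq_closure]; exact Subgroup.subset_closure (by simp)

theorem closure_ab : Subgroup.closure {a f, b f} = H f := by
  rw [H_eq_closure]
  apply le_antisymm
  · rw [Subgroup.closure_le]
    rintro x (rfl | rfl)
    · rw [a_eq]
      exact mul_mem (Subgroup.subset_closure (by simp)) (Subgroup.subset_closure (by simp))
    · exact Subgroup.subset_closure (by simp)
  · rw [Subgroup.closure_le]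
    have hb : b f ∈ Subgroup.closure {a f, b f} := Subgroup.subset_closure (by simp)
    rintro x (rfl | rfl)
    · exact hb
    · have : w f = (b f)⁻¹ * a f := by rw [a_eq, inv_mul_cancel_left]
      rw [this]
      exact mul_mem (inv_mem hb) (Subgroup.subset_closure (by simp))

theorem card_H : Nat.card (H f) = 6 := by
  have hinj : Function.Injective (primeHom f) := by
    intro h k e
    have e := mk_injective (K := GaloisField 2 f) e
    apply Subtype.ext
    ext i j
    exact (algebraMap (ZMod 2) (GaloisField 2 f)).injective
      (congrFun (congrFun (congrArg Subtype.val e) i) j)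
  have e : Nat.card (H f) = Nat.card SL(2, ZMod 2) :=
    Nat.card_congr (MonoidHom.ofInjective hinj).symm.toEquiv
  rw [e, Nat.card_eq_fintype_card]
  decide

/-- The embedding of `T` into `G` as the diagonal subgroup of `T²`. -/
noncomputable def diagHom (f : ℕ) : T f →* G f :=
  SemidirectProduct.inl.comp ((MonoidHom.id _).prod (MonoidHom.id _))

theorem L_eq_map : L f = (H f).map (diagHom f) := by
  rw [← closure_ab, MonoidHom.map_closure, Set.image_pair]
  rfl

theorem diag_mem_L {h : T f} (hh : h ∈ H f) : SemidirectProduct.inl (h, h) ∈ L f := by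
  rw [L_eq_map]
  exact ⟨h, hh, rfl⟩

theorem g_eq (α : GaloisField 2 f) :
    g α = ⟨(u α, b f * u α), ⟨swap f, Subgroup.mem_zpowers _⟩⟩ :=
  (SemidirectProduct.mk_eq_inl_mul_inr _ _).symm

/-- The swap fixes diagonal pairs, and both coordinates of `g_α` are involutions or trivial, so no
inverses appear. -/
theorem g_conj (α : GaloisField 2 f) (h : T f) :
    g α * SemidirectProduct.inl (h, h) * (g α)⁻¹ =
      SemidirectProduct.inl (u α * h * u α, b f * u α * h * (b f * u α)) := by
  rw [mul_inv_eq_iff_eq_mul, g_eq]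
  have e1 := u_mul_self α
  have e2 : b f * u α * (b f * u α) = 1 := by
    rw [b, u_mul]
    exact u_mul_self _
  refine SemidirectProduct.ext (Prod.ext ?_ ?_) (by simp)
  · change u α * h = u α * h * u α * u α
    rw [mul_assoc _ (u α), e1, mul_one]
  · change b f * u α * h = b f * u α * h * (b f * u α) * (b f * u α)
    rw [mul_assoc _ (b f * u α), e2, mul_one]

theorem b_mul_u (α : GaloisField 2 f) : b f * u α = u (α + 1) := by
  rw [b, u_mul, add_comm]

theorem swap_mul_self : swap f * swap f = 1 := rfl

theorem eq_one_or_swap (e : Subgroup.zpowers (swap f)) :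
    e = 1 ∨ e = ⟨swap f, Subgroup.mem_zpowers _⟩ := by
  obtain ⟨_, n, rfl⟩ := e
  rcases Int.even_or_odd' n with ⟨m, rfl | rfl⟩
  · left
    apply Subtype.ext
    change swap f ^ (2 * m) = 1
    rw [zpow_mul, zpow_two, swap_mul_self, one_zpow]
  · right
    apply Subtype.ext
    change swap f ^ (2 * m + 1) = swap f
    rw [zpow_add_one, zpow_mul, zpow_two, swap_mul_self, one_zpow, one_mul]

theorem orderOf_swap : orderOf (swap f) = 2 := by
  refine orderOf_eq_prime (by rw [sq, swap_mul_self]) fun h => ?_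
  exact b_ne_one f (congrArg Prod.fst (DFunLike.congr_fun h ((1, b f) : T f × T f)))

/-- The subgroup of `G` that is generated by `L` and `g_α`. -/
noncomputable def X (α : GaloisField 2 f) : Subgroup (G f) :=
  Subgroup.closure ((L f : Set (G f)) ∪ {g α})

theorem g_mem_X (α : GaloisField 2 f) : g α ∈ X α := Subgroup.subset_closure (.inr rfl)

theorem diag_mem_X (α : GaloisField 2 f) {h : T f} (hh : h ∈ H f) :
    SemidirectProduct.inl (h, h) ∈ X α :=
  Subgroup.subset_closure (.inl (diag_mem_L hh))

theorem conj_mem_X (α : GaloisField 2 f) {h : T f} (hh : h ∈ H f) :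
    SemidirectProduct.inl (u α * h * u α, u (α + 1) * h * u (α + 1)) ∈ X α := by
  rw [← b_mul_u, ← g_conj]
  exact mul_mem (mul_mem (g_mem_X α) (diag_mem_X α hh)) (inv_mem (g_mem_X α))

/-- `eq_top_of_generator` transported to `T`; since `f ≥ 2`, a generator is neither 0 nor 1. -/
theorem eq_top_of_mem {α : GaloisField 2 f} (hf : 2 ≤ f)
    (hα : Subfield.closure {α} = (⊤ : Subfield (GaloisField 2 f)))
    (S : Subgroup (T f)) (hb : b f ∈ S) (hw : w f ∈ S)
    (hu : u α * w f * u α ∈ S) : S = ⊤ := by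
  have h2 := generator_sq_ne_self hf hα
  have := eq_top_of_generator hα (by rintro rfl; simp at h2) (by rintro rfl; simp at h2)
    (S.comap (slEquiv f).toMonoidHom) hb hw
    (by
      change slEquiv f _ ∈ S
      rw [map_mul, map_mul]
      exact hu)
  rw [eq_top_iff]
  intro x _
  have hx : (slEquiv f).symm x ∈ S.comap (slEquiv f).toMonoidHom := by
    rw [this]; exact Subgroup.mem_top _
  have hx' : slEquiv f ((slEquiv f).symm x) ∈ S := hx
  rwa [MulEquiv.apply_symm_apply] at hx'

theorem isSimpleGroup_T (hf : 2 ≤ f) : IsSimpleGroup (T f) := by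
  refine Matrix.ProjectiveSpecialLinearGroup.rank_two_simple ?_
  rw [GaloisField.card 2 f (by omega)]
  exact Nat.pow_le_pow_right (n := 2) two_pos hf

/-- Unless `Γ(f, α)` is connected, `x ↦ x ^ (2 ^ (f / 2))` sends `α` to `α + 1`. -/
theorem X_eq_top_or {α : GaloisField 2 f} (hf : 2 ≤ f)
    (hα : Subfield.closure {α} = (⊤ : Subfield (GaloisField 2 f))) :
    X α = ⊤ ∨ (Even f ∧ α ^ 2 ^ (f / 2) = α + 1) := by
  have := isSimpleGroup_T hf
  let N : Subgroup (T f × T f) := (X α).comap SemidirectProduct.inl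
  have hN : ∀ h ∈ H f, (h, h) ∈ N := fun h hh => diag_mem_X α hh
  have hN' : (u α * w f * u α, u (α + 1) * w f * u (α + 1)) ∈ N := conj_mem_X α w_mem_H
  have p1 : ∀ x, ∃ y, (x, y) ∈ N := by
    have := eq_top_of_mem hf hα (N.map (MonoidHom.fst _ _)) ⟨_, hN _ b_mem_H, rfl⟩
      ⟨_, hN _ w_mem_H, rfl⟩ ⟨_, hN', rfl⟩
    intro x
    obtain ⟨⟨_, y⟩, h, rfl⟩ : x ∈ N.map (MonoidHom.fst _ _) := by
      rw [this]; exact Subgroup.mem_top _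
    exact ⟨y, h⟩
  have p2 : ∀ y, ∃ x, (x, y) ∈ N := by
    have hb := hN _ b_mem_H
    have := eq_top_of_mem hf hα (N.map (MonoidHom.snd _ _)) ⟨_, hb, rfl⟩
      -- Conjugation by `b = u_1` turns `u_(α+1) w u_(α+1)` into `u_α w u_α`, so the same generation
      -- statement serves both projections.
      ⟨_, hN _ w_mem_H, rfl⟩ ⟨_, mul_mem (mul_mem hb hN') hb, by
        have e1 : b f * u (α + 1) = u α := by
          rw [b, u_mul, add_left_comm, CharTwo.add_self_eq_zero, add_zero]
        have e2 : u (α + 1) * b f = u α := by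
          rw [b, u_mul, add_assoc, CharTwo.add_self_eq_zero, add_zero]
        change b f * (u (α + 1) * w f * u (α + 1)) * b f = _
        rw [mul_assoc, mul_assoc (u (α + 1) * w f), e2, ← mul_assoc, ← mul_assoc, e1]⟩
    intro y
    obtain ⟨⟨x, _⟩, h, rfl⟩ : y ∈ N.map (MonoidHom.snd _ _) := by
      rw [this]; exact Subgroup.mem_top _
    exact ⟨x, h⟩
  rcases N.eq_top_or_exists_hom p1 p2 with h | ⟨σ, hσ⟩
  · left
    have hinl : ∀ n, SemidirectProduct.inl n ∈ X α := fun n => by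
      have : n ∈ N := by rw [h]; exact Subgroup.mem_top _
      exact this
    have hπ : π f ∈ X α := by
      have : π f = (SemidirectProduct.inl (u α, b f * u α))⁻¹ * g α := by
        rw [g, inv_mul_cancel_left]
      rw [this]
      exact mul_mem (inv_mem (hinl _)) (g_mem_X α)
    rw [eq_top_iff]
    intro m _
    rw [← SemidirectProduct.inl_left_mul_inr_right m]
    refine mul_mem (hinl _) ?_
    rcases eq_one_or_swap m.right with e | e <;> rw [e]
    · rw [map_one]; exact one_mem _
    · exact hπ
  · right
    let σ' : SL(2, GaloisField 2 f) →* SL(2, GaloisField 2 f) :=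
      ((slEquiv f).symm.toMonoidHom.comp σ).comp (slEquiv f).toMonoidHom
    have hσ' : ∀ x y, (slEquiv f x, slEquiv f y) ∈ N → σ' x = y := by
      intro x y h
      change (slEquiv f).symm (σ (slEquiv f x)) = y
      rw [hσ _ _ h, MulEquiv.symm_apply_apply]
    obtain ⟨φ, hφ⟩ := map_eq_of_hom σ' (hσ' _ _ (hN _ b_mem_H)) (hσ' _ _ (hN _ w_mem_H))
      (x := α) (y := α + 1) (hσ' _ _ (by rw [map_mul, map_mul, map_mul, map_mul]; exact hN'))
    exact even_of_map_eq_add_one hf hα φ hφ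

end TwoArcFamily

/-! ### The disconnected case: the automorphism `ν` and the group `⟨T, ν⟩`. -/

namespace TwoArcFamily

open CharTwoSL

variable {f : ℕ}

theorem τ_slEquiv (h : SL(2, GaloisField 2 f)) : τ f (slEquiv f h) = slEquiv f (frobSL f h) := rfl

theorem τ_pow_slEquiv (n : ℕ) (h : SL(2, GaloisField 2 f)) :
    (τ f ^ n) (slEquiv f h) =
      slEquiv f (Matrix.SpecialLinearGroup.map (iterateFrobenius (GaloisField 2 f) 2 n) h) := by
  induction n with
  | zero =>
    refine congrArg (slEquiv f) (Subtype.ext (Matrix.ext fun i j => ?_))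
    change h.1 i j = h.1 i j ^ 2 ^ 0
    rw [pow_zero, pow_one]
  | succ n ih =>
    rw [pow_succ', MulAut.mul_apply, ih, τ_slEquiv]
    refine congrArg (slEquiv f) (Subtype.ext (Matrix.ext fun i j => ?_))
    change (h.1 i j ^ 2 ^ n) ^ 2 = h.1 i j ^ 2 ^ (n + 1)
    rw [← pow_mul, pow_succ]

theorem τ_pow_u (n : ℕ) (β : GaloisField 2 f) : (τ f ^ n) (u β) = u (β ^ 2 ^ n) := by
  rw [← slEquiv_upper, τ_pow_slEquiv, map_upper]
  rfl

theorem τ_pow_w (n : ℕ) : (τ f ^ n) (w f) = w f := by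
  rw [w, τ_pow_slEquiv, map_weyl]

theorem τ_pow_self (hf : f ≠ 0) : τ f ^ f = 1 := by
  ext x
  obtain ⟨h, rfl⟩ := (slEquiv f).surjective x
  rw [τ_pow_slEquiv, MulAut.one_apply]
  refine congrArg (slEquiv f) (Subtype.ext (Matrix.ext fun i j => ?_))
  change h.1 i j ^ 2 ^ f = h.1 i j
  have := Fintype.ofFinite (GaloisField 2 f)
  have e := FiniteField.pow_card (h.1 i j)
  rwa [← Nat.card_eq_fintype_card, GaloisField.card 2 f hf] at e

/-- `ν` is an involution of `T` that fixes `H` and sends `u_α` to `u_(α + 1)`. -/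
structure IsSwapping (α : GaloisField 2 f) (ν : MulAut (T f)) : Prop where
  sq : ν * ν = 1
  fix : ∀ h ∈ H f, ν h = h
  map_u : ν (u α) = u (α + 1)

theorem isSwapping {α : GaloisField 2 f} (hf : 2 ≤ f) (he : Even f)
    (hα : α ^ 2 ^ (f / 2) = α + 1) : IsSwapping α (τ f ^ (f / 2)) where
  sq := by
    rw [← pow_add, ← two_mul, Nat.two_mul_div_two_of_even he, τ_pow_self (by omega)]
  fix h hh := by
    have : H f ≤ ((τ f ^ (f / 2)).toMonoidHom).eqLocus (MonoidHom.id _) := by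
      rw [H_eq_closure, Subgroup.closure_le]
      rintro x (rfl | rfl)
      · exact (τ_pow_u _ _).trans (by rw [one_pow]; rfl)
      · exact τ_pow_w _
    exact this hh
  map_u := by rw [τ_pow_u, hα]

theorem eq_one_of_commute {x : T f} (hb : x * b f = b f * x) (hw : x * w f = w f * x) :
    x = 1 := by
  obtain ⟨h, rfl⟩ := (slEquiv f).surjective x
  rw [b, ← slEquiv_upper, ← map_mul, ← map_mul] at hb
  rw [w, ← map_mul, ← map_mul] at hw
  rw [CharTwoSL.eq_one_of_commute h ((slEquiv f).injective hb) ((slEquiv f).injective hw), map_one]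

theorem conj_injective : Function.Injective (MulAut.conj : T f →* MulAut (T f)) := by
  rw [injective_iff_map_eq_one]
  intro x hx
  have h : ∀ y, x * y * x⁻¹ = y := fun y => DFunLike.congr_fun hx y
  exact eq_one_of_commute (mul_inv_eq_iff_eq_mul.1 (h _)) (mul_inv_eq_iff_eq_mul.1 (h _))

variable {α : GaloisField 2 f} {ν : MulAut (T f)}

theorem u_add_one_ne_u (α : GaloisField 2 f) : u (α + 1) ≠ u α := by
  intro e
  rw [← b_mul_u] at e
  exact b_ne_one f (mul_eq_right.1 e)

theorem IsSwapping.ne_one (hν : IsSwapping α ν) : ν ≠ 1 := by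
  rintro rfl
  exact u_add_one_ne_u α hν.map_u.symm

/-- As `ν` fixes `H`, such an `x` would centralize `H` and so be trivial. This says that `ν` is not
inner, and makes `toAut` injective. -/
theorem IsSwapping.conj_mul_ne_one (hν : IsSwapping α ν) (x : T f) : MulAut.conj x * ν ≠ 1 := by
  intro hx
  have h : ∀ y ∈ H f, x * y * x⁻¹ = y := fun y hy => by
    have := DFunLike.congr_fun hx y
    rwa [MulAut.mul_apply, hν.fix y hy] at this
  have : x = 1 := eq_one_of_commute (mul_inv_eq_iff_eq_mul.1 (h _ b_mem_H))
    (mul_inv_eq_iff_eq_mul.1 (h _ w_mem_H))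
  rw [this, map_one, one_mul] at hx
  exact hν.ne_one hx

theorem IsSwapping.orderOf_eq (hν : IsSwapping α ν) : orderOf ν = 2 :=
  orderOf_eq_prime (by rw [pow_two, hν.sq]) hν.ne_one

/-- The homomorphism `⟨π⟩ → Aut(T)` that sends `π` to `ν`. -/
noncomputable def IsSwapping.ρ (hν : IsSwapping α ν) :
    Subgroup.zpowers (swap f) →* MulAut (T f) :=
  monoidHomOfForallMemZpowers (g := (⟨swap f, Subgroup.mem_zpowers _⟩ : Subgroup.zpowers (swap f)))
    (g' := ν) (by
      rintro ⟨_, n, rfl⟩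
      exact ⟨n, rfl⟩) (by
      rw [Subgroup.orderOf_mk, orderOf_swap, hν.orderOf_eq])

theorem IsSwapping.ρ_swap (hν : IsSwapping α ν) :
    hν.ρ ⟨swap f, Subgroup.mem_zpowers _⟩ = ν :=
  monoidHomOfForallMemZpowers_apply_gen _ _

theorem IsSwapping.apply_apply (hν : IsSwapping α ν) (x : T f) : ν (ν x) = x :=
  DFunLike.congr_fun hν.sq x

/-- As `ν` is an involution, the swap preserves its graph and acts on first coordinates as `ν`.
Hence `Y` is a subgroup and `toAut` a homomorphism. -/
theorem IsSwapping.smul_graph (hν : IsSwapping α ν) (e : Subgroup.zpowers (swap f)) (x : T f) :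
    e.1 (x, ν x) = (hν.ρ e x, ν (hν.ρ e x)) := by
  rcases eq_one_or_swap e with rfl | rfl
  · rw [map_one]; rfl
  · rw [hν.ρ_swap, hν.apply_apply]; rfl

/-- The elements `(x, ν x) e` of `G` with `x ∈ T` and `e ∈ ⟨π⟩`. -/
noncomputable def IsSwapping.Y (hν : IsSwapping α ν) : Subgroup (G f) where
  carrier := {m | m.left.2 = ν m.left.1}
  one_mem' := (map_one ν).symm
  mul_mem' := by
    intro m m' hm hm'
    have e : m'.left = (m'.left.1, ν m'.left.1) := Prod.ext rfl hm'
    have e' := hν.smul_graph m.right m'.left.1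
    rw [← e] at e'
    change m.left.2 * (m.right.1 m'.left).2 = ν (m.left.1 * (m.right.1 m'.left).1)
    rw [e', map_mul, ← hm]
  inv_mem' := by
    intro m hm
    have e : m.left⁻¹ = ((m.left⁻¹).1, ν (m.left⁻¹).1) := Prod.ext rfl (by
      change (m.left.2)⁻¹ = ν (m.left.1)⁻¹
      rw [map_inv, ← hm])
    have e' := hν.smul_graph m.right⁻¹ (m.left⁻¹).1
    rw [← e] at e'
    change (m.right⁻¹.1 m.left⁻¹).2 = ν (m.right⁻¹.1 m.left⁻¹).1
    rw [e']

theorem IsSwapping.mem_Y (hν : IsSwapping α ν) {m : G f} :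
    m ∈ hν.Y ↔ m.left.2 = ν m.left.1 := Iff.rfl

/-- The generators of `X α` lie in `Y`. Conversely, the `x` with `(x, ν x) ∈ X α` form a subgroup
containing `b`, `w` and `u_α w u_α`, hence are all of `T`; then `π` is obtained from `g_α`. -/
theorem IsSwapping.X_eq_Y (hν : IsSwapping α ν) (hf : 2 ≤ f)
    (hα : Subfield.closure {α} = (⊤ : Subfield (GaloisField 2 f))) : X α = hν.Y := by
  apply le_antisymm
  · rw [X, Subgroup.closure_le]
    rintro m (hm | rfl)
    · rw [L_eq_map] at hm
      obtain ⟨h, hh, rfl⟩ := hm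
      exact (hν.fix h hh).symm
    · change (g α).left.2 = ν (g α).left.1
      rw [g_eq]
      change b f * u α = ν (u α)
      rw [b_mul_u, hν.map_u]
  · let i : T f →* G f := SemidirectProduct.inl.comp ((MonoidHom.id _).prod ν.toMonoidHom)
    have hi : ∀ h ∈ H f, i h ∈ X α := fun h hh => by
      have : i h = SemidirectProduct.inl (h, h) := by
        change SemidirectProduct.inl (h, ν h) = _
        rw [hν.fix h hh]
      rw [this]
      exact diag_mem_X α hh
    have htop := eq_top_of_mem hf hα ((X α).comap i) (hi _ b_mem_H) (hi _ w_mem_H) (by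
      change SemidirectProduct.inl (u α * w f * u α, ν (u α * w f * u α)) ∈ X α
      rw [map_mul, map_mul, hν.map_u, hν.fix _ w_mem_H]
      exact conj_mem_X α w_mem_H)
    have hall : ∀ x, SemidirectProduct.inl (x, ν x) ∈ X α := fun x => by
      have : x ∈ (X α).comap i := by rw [htop]; exact Subgroup.mem_top _
      exact this
    have hπ : π f ∈ X α := by
      have : π f = (SemidirectProduct.inl (u α, b f * u α))⁻¹ * g α := by
        rw [g, inv_mul_cancel_left]
      rw [this, b_mul_u, ← hν.map_u]
      exact mul_mem (inv_mem (hall _)) (g_mem_X α)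
    intro m hm
    rw [← SemidirectProduct.inl_left_mul_inr_right m]
    refine mul_mem ?_ ?_
    · have : m.left = (m.left.1, ν m.left.1) := Prod.ext rfl hm
      rw [this]
      exact hall _
    · rcases eq_one_or_swap m.right with e | e <;> rw [e]
      · rw [map_one]; exact one_mem _
      · exact hπ

/-- The homomorphism that sends `(x, ν x) π ^ i` to `x ν ^ i`. -/
noncomputable def IsSwapping.toAut (hν : IsSwapping α ν) : hν.Y →* MulAut (T f) :=
  MonoidHom.mk' (fun m => MulAut.conj m.1.left.1 * hν.ρ m.1.right) (by
    intro m m'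
    have e : m'.1.left = (m'.1.left.1, ν m'.1.left.1) := Prod.ext rfl m'.2
    have e' := hν.smul_graph m.1.right m'.1.left.1
    rw [← e] at e'
    have e1 : (m * m').1.left.1 = m.1.left.1 * hν.ρ m.1.right m'.1.left.1 :=
      congrArg (fun z : T f × T f => m.1.left.1 * z.1) e'
    have e2 : (m * m').1.right = m.1.right * m'.1.right := rfl
    have e3 : MulAut.conj (hν.ρ m.1.right m'.1.left.1) =
        hν.ρ m.1.right * MulAut.conj m'.1.left.1 * (hν.ρ m.1.right)⁻¹ := by
      ext x
      simp [MulAut.mul_apply]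
    rw [e1, e2, map_mul, map_mul, e3]
    group)

theorem IsSwapping.toAut_apply (hν : IsSwapping α ν) (m : hν.Y) :
    hν.toAut m = MulAut.conj m.1.left.1 * hν.ρ m.1.right := rfl

theorem IsSwapping.toAut_injective (hν : IsSwapping α ν) : Function.Injective hν.toAut := by
  rw [injective_iff_map_eq_one]
  intro m hm
  rw [hν.toAut_apply] at hm
  rcases eq_one_or_swap m.1.right with e | e
  · rw [e, map_one, mul_one] at hm
    have h1 : m.1.left.1 = 1 := conj_injective (hm.trans (map_one _).symm)
    have h2 : m.1.left.2 = 1 := by rw [hν.mem_Y.1 m.2, h1, map_one]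
    exact Subtype.ext (SemidirectProduct.ext (Prod.ext h1 h2) e)
  · rw [e, hν.ρ_swap] at hm
    exact absurd hm (hν.conj_mul_ne_one _)

theorem IsSwapping.range_toAut (hν : IsSwapping α ν) : hν.toAut.range = extT f ν := by
  apply le_antisymm
  · rintro _ ⟨m, rfl⟩
    rw [hν.toAut_apply]
    refine mul_mem (Subgroup.mem_sup_left ⟨_, rfl⟩) (Subgroup.mem_sup_right ?_)
    rcases eq_one_or_swap m.1.right with e | e <;> rw [e]
    · rw [map_one]; exact one_mem _
    · rw [hν.ρ_swap]; exact Subgroup.mem_zpowers _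
  · refine sup_le ?_ (Subgroup.zpowers_le.2 ?_)
    · rintro _ ⟨x, rfl⟩
      refine ⟨⟨SemidirectProduct.inl (x, ν x), rfl⟩, ?_⟩
      rw [hν.toAut_apply]
      change MulAut.conj x * hν.ρ 1 = _
      rw [map_one, mul_one]
    · refine ⟨⟨π f, (map_one ν).symm⟩, ?_⟩
      rw [hν.toAut_apply]
      change MulAut.conj 1 * hν.ρ ⟨swap f, Subgroup.mem_zpowers _⟩ = _
      rw [hν.ρ_swap, map_one, one_mul]

/-- The isomorphism of the group generated by `L` and `g_α` with `⟨T, ν⟩`. -/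
noncomputable def IsSwapping.equivExt (hν : IsSwapping α ν) : hν.Y ≃* extT f ν :=
  (MonoidHom.ofInjective hν.toAut_injective).trans (MulEquiv.subgroupCongr hν.range_toAut)

theorem IsSwapping.equivExt_coe (hν : IsSwapping α ν) (m : hν.Y) :
    (hν.equivExt m : MulAut (T f)) = hν.toAut m := rfl

theorem IsSwapping.equivExt_mem_iff (hν : IsSwapping α ν) (m : hν.Y) :
    hν.equivExt m ∈ extH f ν ↔ (m : G f) ∈ L f := by
  have hd : ∀ h, h ∈ H f → ∃ hm : diagHom f h ∈ hν.Y, hν.toAut ⟨_, hm⟩ = MulAut.conj h := by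
    intro h hh
    refine ⟨(hν.fix h hh).symm, ?_⟩
    rw [hν.toAut_apply]
    change MulAut.conj h * hν.ρ 1 = _
    rw [map_one, mul_one]
  rw [extH, Subgroup.mem_subgroupOf, hν.equivExt_coe, L_eq_map]
  constructor
  · rintro ⟨h, hh, e⟩
    obtain ⟨hm, e'⟩ := hd h hh
    exact ⟨h, hh, congrArg Subtype.val (hν.toAut_injective (e'.trans e))⟩
  · rintro ⟨h, hh, e⟩
    obtain ⟨hm, e'⟩ := hd h hh
    refine ⟨h, hh, ?_⟩
    refine Eq.trans e'.symm ?_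
    exact congrArg hν.toAut (Subtype.ext e)

theorem IsSwapping.equivExt_g (hν : IsSwapping α ν) (h : g α ∈ hν.Y) :
    hν.equivExt ⟨g α, h⟩ = extU α ν := by
  apply Subtype.ext
  rw [hν.equivExt_coe, hν.toAut_apply]
  change MulAut.conj (g α).left.1 * hν.ρ (g α).right = MulAut.conj (u α) * ν
  rw [g_eq, hν.ρ_swap]

theorem IsSwapping.card_Y (hν : IsSwapping α ν) : Nat.card hν.Y = 2 * Nat.card (T f) := by
  have h2 : Nat.card (Subgroup.zpowers (swap f)) = 2 := by rw [Nat.card_zpowers, orderOf_swap]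
  refine Eq.trans ?_ (congrArg (· * Nat.card (T f)) h2)
  refine Eq.trans ?_ (Nat.card_prod _ _)
  exact Nat.card_congr
    { toFun := fun m => (m.1.right, m.1.left.1)
      invFun := fun p => ⟨⟨(p.2, ν p.2), p.1⟩, rfl⟩
      left_inv := fun m => Subtype.ext (SemidirectProduct.ext (Prod.ext rfl m.2.symm) rfl)
      right_inv := fun _ => rfl }

theorem IsSwapping.index_Y (hν : IsSwapping α ν) : hν.Y.index = Nat.card (T f) := by
  have h := hν.Y.card_mul_index
  rw [hν.card_Y, SemidirectProduct.card, Nat.card_prod, Nat.card_zpowers, orderOf_swap] at h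
  have hpos : 0 < Nat.card (T f) := Nat.card_pos
  refine Nat.eq_of_mul_eq_mul_left (mul_pos two_pos hpos) (h.trans ?_)
  ring

theorem card_extH (f : ℕ) (ν : MulAut (T f)) : Nat.card (extH f ν) = 6 := by
  rw [← card_H (f := f), extH]
  have hle : (H f).map (MulAut.conj : T f →* MulAut (T f)) ≤ extT f ν := by
    rintro _ ⟨x, -, rfl⟩
    exact Subgroup.mem_sup_left ⟨x, rfl⟩
  rw [Nat.card_congr (Subgroup.subgroupOfEquivOfLe hle).toEquiv]
  exact Nat.card_congr ((H f).equivMapOfInjective _ conj_injective).symm.toEquiv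

/-- `⟨T, ν⟩` has order `2 |T|` and the copy of `H` in it has order 6. -/
theorem IsSwapping.card_cosets (hν : IsSwapping α ν) :
    (Nat.card (Quotient (QuotientGroup.rightRel (extH f ν))) : ℚ) = (Nat.card (T f) : ℚ) / 3 := by
  have h := (extH f ν).card_mul_index
  rw [card_extH, ← Nat.card_congr hν.equivExt.toEquiv, hν.card_Y, Subgroup.index_eq_card,
    ← Nat.card_congr (QuotientGroup.quotientRightRelEquivQuotientLeftRel (extH f ν))] at h
  have h' := congrArg (Nat.cast : ℕ → ℚ) h
  push_cast at h'
  linarith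

end TwoArcFamily


/-! ### The proposition. -/

theorem proposition6p4 (f : ℕ) (hf : 2 ≤ f) (α : GaloisField 2 f)
    (hα : Subfield.closure {α} = (⊤ : Subfield (GaloisField 2 f))) :
    ((Odd f ∨ (Even f ∧ α ^ 2 ^ (f / 2) ≠ α + 1)) → (TwoArcFamily.Γ f α).Connected) ∧
    ((Even f ∧ α ^ 2 ^ (f / 2) = α + 1) →
      Nat.card (TwoArcFamily.Γ f α).ConnectedComponent = Nat.card (TwoArcFamily.T f) ∧
      (∀ C : (TwoArcFamily.Γ f α).ConnectedComponent,
        (Nat.card C : ℚ) = (Nat.card (TwoArcFamily.T f) : ℚ) / 3) ∧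
      ∀ ν : MulAut (TwoArcFamily.T f), ν = TwoArcFamily.τ f ^ (f / 2) →
        ∃ (hsymm : DoubleCoset.doubleCoset (TwoArcFamily.extU α ν)
              (TwoArcFamily.extH f ν : Set _) (TwoArcFamily.extH f ν) =
            DoubleCoset.doubleCoset (TwoArcFamily.extU α ν)⁻¹
              (TwoArcFamily.extH f ν : Set _) (TwoArcFamily.extH f ν))
          (hg : TwoArcFamily.extU α ν ∉ TwoArcFamily.extH f ν),
          ∀ C : (TwoArcFamily.Γ f α).ConnectedComponent,
            Nonempty (C.toSimpleGraph ≃g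
              cosetGraph (TwoArcFamily.extH f ν) (TwoArcFamily.extU α ν) hsymm hg)) := by
  constructor
  · intro h
    refine cosetGraph_connected ((TwoArcFamily.X_eq_top_or hf hα).resolve_right ?_)
    rintro ⟨he, hα'⟩
    rcases h with ho | ⟨-, hne⟩
    · exact Nat.not_odd_iff_even.2 he ho
    · exact hne hα'
  · rintro ⟨he, hα'⟩
    have hν := TwoArcFamily.isSwapping hf he hα'
    have hX := hν.X_eq_Y hf hα
    -- The coset graph of `⟨T, ν⟩` is well defined because both conditions carry over from `G` along
    -- the isomorphism.
    have hs := doubleCoset_eq_inv_of_equiv hν.equivExt hX hν.equivExt_mem_iff hν.equivExt_g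
      (TwoArcFamily.g_doubleCoset α)
    have hg : TwoArcFamily.extU α (TwoArcFamily.τ f ^ (f / 2)) ∉
        TwoArcFamily.extH f (TwoArcFamily.τ f ^ (f / 2)) := by
      have hgY : TwoArcFamily.g α ∈ hν.Y := hX ▸ TwoArcFamily.g_mem_X α
      rw [← hν.equivExt_g hgY, hν.equivExt_mem_iff]
      exact TwoArcFamily.g_notMem α
    have hiso := nonempty_component_iso (hs := TwoArcFamily.g_doubleCoset α)
      (hg := TwoArcFamily.g_notMem α) (hs' := hs) (hg' := hg) hν.equivExt hX
      hν.equivExt_mem_iff hν.equivExt_g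
    refine ⟨?_, fun C => ?_, ?_⟩
    · exact card_connectedComponent_cosetGraph.trans
        ((congrArg Subgroup.index hX).trans hν.index_Y)
    · rw [← hν.card_cosets]
      exact_mod_cast Nat.card_congr (hiso C).some.toEquiv
    · rintro ν rfl
      exact ⟨hs, hg, hiso⟩
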